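/- **Setting.** Let $R$ be a noetherian commutative ring and $M\subseteq\mathbb Z^d$ an affine positive normal monoid, written additively: $M$ is a finitely generated submonoid of some $\mathbb Z^d$, its only unit is $0$, and $x\in\mathrm{gp}(M)$, $kx\in M$, $k\ge 1$ imply $x\in M$, where $\mathrm{gp}(M)$ is the group completion. Let $C=\mathbb R_+M\subseteq\mathbb R^d$ be its cone, let $\alpha$ lie in the interior of the dual cone $C^*$, let $a>0$, and put $\mathcal H=\{\alpha=a\}$. Let $\phi(M)=\mathcal H\cap C$, let $\phi(x)$ be the point of $\mathbb R_+x\cap\mathcal H$ for $0\ne x\in M$, and for a polytope $Q$ (possibly empty) let $M(Q)=\{x\in M\setminus\{0\}\mid\phi(x)\in Q\}\cup\{0\}$. An element $m\in M$ is an *extremal generator* if $\phi(m)$ is a vertex of $\phi(M)$ and $\mathbb R_+m\cap M\simeq\mathbb Z_+$. A *pyramidal decomposition* $M=M(\Delta)\cup M(\Gamma)$ with respect to the extremal generator $m$ is given by polytopes $\Delta,\Gamma$ such that $\phi(M)=\Delta\cup\Gamma$, $\Delta\cap\Gamma$ is a face of $\Gamma$, and $\Delta=\mathrm{conv}(\Delta\cap\Gamma,\phi(m))$.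 Let $\delta:\mathbb R^d\to\mathbb R$ be a linear map vanishing on $\Delta\cap\Gamma$ with $\delta(\mathrm{gp}(M))=\mathbb Z$, $\delta\le 0$ on $\Gamma$ and $\delta\ge 0$ on $\Delta$. The associated *pyramidal degree* of $f=\sum r_im_i\in R[M]$ is $\max\{\delta(m_i)\mid r_i\neq 0\}$; the leading term $\mathcal H(f)$ is the sum of the terms of $f$ of highest degree; $f$ is *monic in $m$* if $\mathcal H(f)=r\,m^c$ (the monomial of $cm$ with coefficient $r$) for a unit $r\in R^\times$ and some $c\in\mathbb N$. For a commutative ring $A$, put $\sigma=(1\,2)(3\,4)\cdots(2n{-}1\;2n)$ and let $e_{ij}$ be the matrix units. Let $\mathrm{ESp}_{2n}(A)$ be the group generated by all $\mathrm{Id}+\lambda e_{i\sigma(i)}$ and all $\mathrm{Id}+\lambda e_{ij}-\lambda(-1)^{i+j}e_{\sigma(j)\sigma(i)}$, and $\mathrm{EO}_{2n}(A)$ the group generated by all $\mathrm{Id}+\lambda e_{ij}-\lambda e_{\sigma(j)\sigma(i)}$, where in the last two families $i<j$, $\sigma(i)\ne j$, and always $\lambda\in A$. They act on rows of length $2n$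 by right multiplication; $e_1=(1,0,\dots,0)$. **Statement.** Let $n\ge 2$ and let $u=(u_1,\dots,u_{2n})\in R[M]^{2n}$ be a unimodular row whose last entry $u_{2n}$ is monic in $m$ for the pyramidal degree. Let $\mathfrak m$ be a maximal ideal of $R[M(\Gamma)]$, let $R[M]_{\mathfrak m}$ be the localization of $R[M]$ at the multiplicative set $R[M(\Gamma)]\setminus\mathfrak m$, and let $u_{\mathfrak m}$ be the image of $u$ over it. Then: 1. (symplectic case) $u_{\mathfrak m}$ and $e_1$ lie in the same orbit of $\mathrm{ESp}_{2n}(R[M]_{\mathfrak m})$; 2. (orthogonal case) if moreover $n\ge 3$, $2$ is not a zero divisor in $R$, and $u$ is isotropic, i.e. $\langle u,u\rangle=2\sum_{i=1}^n u_{2i-1}u_{2i}=0$, then $u_{\mathfrak m}$ and $e_1$ lie in the same orbit of $\mathrm{EO}_{2n}(R[M]_{\mathfrak m})$. -/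

import Mathlib

noncomputable section

namespace PyramidalMonoid

/-! ### Affine positive normal monoids and their polytopes (additive notation) -/

section Monoids

variable {d : ℕ}

/-- The inclusion of the lattice `ℤ^d` in `ℝ^d`. -/
def toReal (x : Fin d → ℤ) : Fin d → ℝ := fun i => (x i : ℝ)

/-- The group completion `gp(M)` of `M ⊆ ℤ^d`, realized inside `ℤ^d`. -/
def gp (M : AddSubmonoid (Fin d → ℤ)) : AddSubgroup (Fin d → ℤ) :=
  AddSubgroup.closure (M : Set (Fin d → ℤ))

/-- Affine positive normal monoids: finitely generated submonoids `M` of some `ℤ^d` whose only unit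
is `0` and which are integrally closed in `gp(M)`. -/
structure IsAffinePositiveNormal (M : AddSubmonoid (Fin d → ℤ)) : Prop where
  fg : M.FG
  positive : ∀ x ∈ M, -x ∈ M → x = 0
  normal : ∀ x ∈ gp M, ∀ k : ℕ, 0 < k → k • x ∈ M → x ∈ M

/-- The cone `ℝ₊M` of all nonnegative real linear combinations of elements of `M`. -/
def cone (M : AddSubmonoid (Fin d → ℤ)) : Set (Fin d → ℝ) :=
  (Submodule.span NNReal (toReal '' (M : Set (Fin d → ℤ))) : Submodule NNReal (Fin d → ℝ))

/-- The dual cone of the cone of `M`. -/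
def dualCone (M : AddSubmonoid (Fin d → ℤ)) : Set ((Fin d → ℝ) →L[ℝ] ℝ) :=
  {l | ∀ c ∈ cone M, 0 ≤ l c}

/-- A hyperplane `{x | α x = a}` with `α` in the interior of the dual cone and `a > 0`, used to cut
the polytope `φ(M)` out of the cone of `M`. -/
structure CuttingHyperplane (M : AddSubmonoid (Fin d → ℤ)) where
  α : (Fin d → ℝ) →L[ℝ] ℝ
  a : ℝ
  α_mem : α ∈ interior (dualCone M)
  a_pos : 0 < a

theorem toReal_mem_cone {M : AddSubmonoid (Fin d → ℤ)} {x : Fin d → ℤ} (hx : x ∈ M) :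
    toReal x ∈ cone M :=
  Submodule.subset_span ⟨x, hx, rfl⟩

theorem toReal_add (x y : Fin d → ℤ) : toReal (x + y) = toReal x + toReal y := by
  funext i
  simp [toReal]

/-- A functional in the interior of the dual cone is positive on the nonzero elements of `M`. -/
theorem CuttingHyperplane.pos {M : AddSubmonoid (Fin d → ℤ)} (H : CuttingHyperplane M)
    {x : Fin d → ℤ} (hx : x ∈ M) (h0 : x ≠ 0) : 0 < H.α (toReal x) := by
  obtain ⟨i, hi⟩ : ∃ i, x i ≠ 0 := by
    by_contra! h
    exact h0 (funext h)
  let β : (Fin d → ℝ) →L[ℝ] ℝ := (x i : ℝ) • ContinuousLinearMap.proj i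
  have hcont : Continuous fun t : ℝ => H.α - t • β := by fun_prop
  have hnhds : dualCone M ∈ nhds ((fun t : ℝ => H.α - t • β) 0) := by
    simpa using mem_interior_iff_mem_nhds.1 H.α_mem
  obtain ⟨ε, hε, hball⟩ := Metric.mem_nhds_iff.1 (hcont.continuousAt.preimage_mem_nhds hnhds)
  have hmem : ε / 2 ∈ Metric.ball (0 : ℝ) ε := by
    rw [Metric.mem_ball, Real.dist_eq, sub_zero, abs_of_pos (by linarith)]
    linarith
  have h1 : 0 ≤ (H.α - (ε / 2) • β) (toReal x) := hball hmem _ (toReal_mem_cone hx)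
  have h2 : β (toReal x) = (x i : ℝ) * x i := by simp [β, toReal]
  have h3 : (0 : ℝ) < (x i : ℝ) * x i := by
    have : (x i : ℝ) ≠ 0 := by exact_mod_cast hi
    exact mul_self_pos.2 this
  have h4 : 0 ≤ H.α (toReal x) - ε / 2 * ((x i : ℝ) * x i) := by simpa [h2] using h1
  nlinarith [mul_pos hε h3]

/-- `φ(x)`: the point where the ray `ℝ₊x` meets the cutting hyperplane, for `x ∈ M`, `x ≠ 0`. -/
def CuttingHyperplane.phi {M : AddSubmonoid (Fin d → ℤ)} (H : CuttingHyperplane M)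
    (x : Fin d → ℤ) : Fin d → ℝ :=
  (H.a / H.α (toReal x)) • toReal x

/-- The polytope `φ(M)`: the intersection of the cone of `M` with the cutting hyperplane. -/
def CuttingHyperplane.polytope {M : AddSubmonoid (Fin d → ℤ)} (H : CuttingHyperplane M) :
    Set (Fin d → ℝ) :=
  {x | H.α x = H.a} ∩ cone M

/-- The submonoid `M(Q) = {x ∈ M \ {0} | φ(x) ∈ Q} ∪ {0}` of `M`, for a convex set `Q`. -/
def CuttingHyperplane.submonoid {M : AddSubmonoid (Fin d → ℤ)} (H : CuttingHyperplane M)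
    (Q : Set (Fin d → ℝ)) (hQ : Convex ℝ Q) : AddSubmonoid M where
  carrier := {x | x = 0 ∨ H.phi x ∈ Q}
  zero_mem' := Or.inl rfl
  add_mem' := by
    rintro x y hx hy
    by_cases hx0 : x = 0
    · subst hx0
      simpa using hy
    by_cases hy0 : y = 0
    · subst hy0
      simpa using hx
    right
    have hxQ : H.phi x ∈ Q := hx.resolve_left hx0
    have hyQ : H.phi y ∈ Q := hy.resolve_left hy0
    have px : 0 < H.α (toReal x) := H.pos x.2 (by simpa using hx0)
    have py : 0 < H.α (toReal y) := H.pos y.2 (by simpa using hy0)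
    have key := hQ hxQ hyQ
      (a := H.α (toReal x) / (H.α (toReal x) + H.α (toReal y)))
      (b := H.α (toReal y) / (H.α (toReal x) + H.α (toReal y)))
      (by positivity) (by positivity) (by field_simp)
    convert key using 1
    simp only [CuttingHyperplane.phi, AddSubmonoid.coe_add, toReal_add, map_add, smul_add,
      smul_smul]
    congr 2 <;> field_simp

/-- Polytopes: convex hulls of finite sets of points. -/
def IsPolytope (Q : Set (Fin d → ℝ)) : Prop :=
  ∃ s : Finset (Fin d → ℝ), Q = convexHull ℝ (s : Set (Fin d → ℝ))

theorem IsPolytope.convex {Q : Set (Fin d → ℝ)} (h : IsPolytope Q) : Convex ℝ Q := by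
  obtain ⟨s, rfl⟩ := h
  exact convex_convexHull ℝ _

/-- The submonoid `ℝ₊m ∩ M` of `M`. -/
def rayMonoid (M : AddSubmonoid (Fin d → ℤ)) (m : Fin d → ℤ) : AddSubmonoid (Fin d → ℤ) where
  carrier := {x | x ∈ M ∧ ∃ t : ℝ, 0 ≤ t ∧ toReal x = t • toReal m}
  zero_mem' := ⟨M.zero_mem, 0, le_rfl, by funext i; simp [toReal]⟩
  add_mem' := by
    rintro x y ⟨hx, s, hs, hxs⟩ ⟨hy, t, ht, hyt⟩
    exact ⟨M.add_mem hx hy, s + t, add_nonneg hs ht, by rw [toReal_add, hxs, hyt, add_smul]⟩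

/-- `m ∈ M` is an extremal generator if `φ(m)` is a vertex of `φ(M)` and `ℤ₊ ≃ ℝ₊m ∩ M`. -/
structure IsExtremalGenerator {M : AddSubmonoid (Fin d → ℤ)} (H : CuttingHyperplane M) (m : M) :
    Prop where
  vertex : H.phi m ∈ Set.extremePoints ℝ H.polytope
  ray : Nonempty (ℕ ≃+ rayMonoid M m)

/-- `M = M(Δ) ∪ M(Γ)` is a pyramidal decomposition with respect to the extremal generator `m`. -/
structure IsPyramidalDecomposition {M : AddSubmonoid (Fin d → ℤ)} (H : CuttingHyperplane M)
    (m : M) (Δ Γ : Set (Fin d → ℝ)) : Prop where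
  extremal : IsExtremalGenerator H m
  polytope_Δ : IsPolytope Δ
  polytope_Γ : IsPolytope Γ
  union : H.polytope = Δ ∪ Γ
  face : IsExposed ℝ Γ (Δ ∩ Γ)
  pyramid : Δ = convexHull ℝ (insert (H.phi m) (Δ ∩ Γ))

/-- The linear maps `δ` that define the pyramidal degree: `δ` vanishes on `Δ ∩ Γ`, is nonpositive on
`Γ`, nonnegative on `Δ`, and maps the lattice `gp(M)` onto `ℤ`. -/
structure IsPyramidalFunctional (M : AddSubmonoid (Fin d → ℤ)) (Δ Γ : Set (Fin d → ℝ))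
    (δ : (Fin d → ℝ) →ₗ[ℝ] ℝ) : Prop where
  vanish : ∀ x ∈ Δ ∩ Γ, δ x = 0
  nonpos : ∀ x ∈ Γ, δ x ≤ 0
  nonneg : ∀ x ∈ Δ, 0 ≤ δ x
  onto : (fun x => δ (toReal x)) '' (gp M : Set (Fin d → ℤ)) = Set.range ((↑) : ℤ → ℝ)

variable {R : Type*} [CommRing R] {M : AddSubmonoid (Fin d → ℤ)}

/-- The degree `max δ(mᵢ)` of `f = ∑ rᵢ mᵢ` in `R[M]`; the degree of `0` is `⊥`. -/
def pyramidalDegree (δ : (Fin d → ℝ) →ₗ[ℝ] ℝ) (f : AddMonoidAlgebra R M) : WithBot ℝ :=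
  f.coeff.support.sup fun x => ((δ (toReal x) : ℝ) : WithBot ℝ)

open Classical in
/-- The leading term of `f`: the sum of all terms of `f` of highest degree. -/
def leadingTerm (δ : (Fin d → ℝ) →ₗ[ℝ] ℝ) (f : AddMonoidAlgebra R M) : AddMonoidAlgebra R M :=
  ∑ x ∈ f.coeff.support.filter fun x : M =>
      ((δ (toReal x) : ℝ) : WithBot ℝ) = pyramidalDegree δ f,
    AddMonoidAlgebra.single x (f.coeff x)

/-- `f` is monic in `m`: its leading term is `r m^c`, for a unit `r` of `R` and `c ∈ ℕ`. -/
def IsMonicIn (δ : (Fin d → ℝ) →ₗ[ℝ] ℝ) (m : M) (f : AddMonoidAlgebra R M) : Prop :=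
  ∃ (r : Rˣ) (c : ℕ), leadingTerm δ f = AddMonoidAlgebra.single (c • m) (r : R)

variable (R) in
/-- The inclusion `R[N] → R[M]` for a submonoid `N` of `M`. -/
def inclusion (N : AddSubmonoid M) : AddMonoidAlgebra R N →+* AddMonoidAlgebra R M :=
  AddMonoidAlgebra.mapDomainRingHom R N.subtype

/-- The localization `R[M]_𝔪` of `R[M]` at a prime `𝔪` of the subring `R[N]`: the elements of
`R[N] \ 𝔪` are inverted. -/
abbrev LocalizedAt (N : AddSubmonoid M) (𝔪 : Ideal (AddMonoidAlgebra R N)) [𝔪.IsPrime] : Type _ :=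
  Localization (𝔪.primeCompl.map (inclusion R N))

/-- The image `u_𝔪` in `R[M]_𝔪` of a row `u` over `R[M]`. -/
def localizeRow {ι : Type*} (N : AddSubmonoid M) (𝔪 : Ideal (AddMonoidAlgebra R N)) [𝔪.IsPrime]
    (u : ι → AddMonoidAlgebra R M) : ι → LocalizedAt N 𝔪 :=
  fun i => algebraMap (AddMonoidAlgebra R M) (LocalizedAt N 𝔪) (u i)

end Monoids

/-! ### Unimodular rows and elementary classical groups of size `2n`

Indices run over `Fin (2 * n)`, so that the position `k` of the text is the index `k - 1`. -/

section Groups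

variable {n : ℕ}

/-- The permutation `(1 2)(3 4) ⋯ (2n-1 2n)`. -/
def sig (i : Fin (2 * n)) : Fin (2 * n) :=
  ⟨if (i : ℕ) % 2 = 0 then i + 1 else i - 1, by have := i.2; split_ifs <;> omega⟩

variable (A : Type*) [CommRing A]

/-- The Gram matrix `ψ_n = ψ_1 ⊥ ⋯ ⊥ ψ_1` of the orthogonal form, `ψ_1 = (0 1; 1 0)`. -/
def psi (n : ℕ) : Matrix (Fin (2 * n)) (Fin (2 * n)) A :=
  Matrix.of fun i j => if sig i = j then 1 else 0

variable {A}

/-- `Id + λ e_{i σ(i)}`. -/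
def symplecticDiag (i : Fin (2 * n)) (l : A) : Matrix (Fin (2 * n)) (Fin (2 * n)) A :=
  1 + Matrix.single i (sig i) l

/-- `se_{ij}(λ) = Id + λ e_{ij} - λ (-1)^{i+j} e_{σ(j)σ(i)}`. -/
def se (i j : Fin (2 * n)) (l : A) : Matrix (Fin (2 * n)) (Fin (2 * n)) A :=
  1 + Matrix.single i j l - Matrix.single (sig j) (sig i) (l * (-1) ^ ((i : ℕ) + (j : ℕ)))

/-- `oe_{ij}(λ) = Id + λ e_{ij} - λ e_{σ(j)σ(i)}`. -/
def oe (i j : Fin (2 * n)) (l : A) : Matrix (Fin (2 * n)) (Fin (2 * n)) A :=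
  1 + Matrix.single i j l - Matrix.single (sig j) (sig i) l

variable (A) in
/-- The elementary symplectic group `ESp_{2n}(A)`. -/
def ESp (n : ℕ) : Subgroup (Matrix.GeneralLinearGroup (Fin (2 * n)) A) :=
  Subgroup.closure
    {g | (∃ i l, (g : Matrix (Fin (2 * n)) (Fin (2 * n)) A) = symplecticDiag i l) ∨
      ∃ i j l, i < j ∧ sig i ≠ j ∧ (g : Matrix (Fin (2 * n)) (Fin (2 * n)) A) = se i j l}

variable (A) in
/-- The elementary orthogonal group `EO_{2n}(A)`. -/
def EO (n : ℕ) : Subgroup (Matrix.GeneralLinearGroup (Fin (2 * n)) A) :=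
  Subgroup.closure
    {g | ∃ i j l, i < j ∧ sig i ≠ j ∧ (g : Matrix (Fin (2 * n)) (Fin (2 * n)) A) = oe i j l}

/-- Unimodular rows. -/
def IsUnimodular (u : Fin (2 * n) → A) : Prop :=
  ∃ s : Fin (2 * n) → A, ∑ i, u i * s i = 1

/-- Isotropic rows for the orthogonal form: `⟨u, u⟩ = uᵀ ψ_n u = 0`. -/
def IsIsotropic (u : Fin (2 * n) → A) : Prop :=
  u ⬝ᵥ (psi A n).mulVec u = 0

/-- `u ∼ v` for the action of `E` on rows by right multiplication. -/
def OrbitRel (E : Subgroup (Matrix.GeneralLinearGroup (Fin (2 * n)) A)) (u v : Fin (2 * n) → A) :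
    Prop :=
  ∃ g ∈ E, Matrix.vecMul u (g : Matrix (Fin (2 * n)) (Fin (2 * n)) A) = v

/-- The first standard basis row `e_1` of length `2n`. -/
def e₁ : Fin (2 * n) → A := fun i => if (i : ℕ) = 0 then 1 else 0

end Groups

end PyramidalMonoid

end

open PyramidalMonoid

namespace PyramidalMonoid

/-! ### Row moves of the elementary symplectic and orthogonal groups. -/

section Groups

open Matrix

variable {n : ℕ} {A : Type*} [CommRing A]

/-! Write `T = R[M(Γ)]` and `S = R[M]`. The row is changed over `S` until its entries at two
positions `a`, `z` in different pairs generate the unit ideal over `S_𝔪`; over `S_𝔪` such a row can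
be cleared to `e₁`.

What makes this possible is that `S/(f)` is integral over `T` for every monic `f`. If `φ(m) ∈ Γ`,
then `M(Γ) = M` and this is trivial. Otherwise put `q = δ(m) > 0`. An `x` outside `M(Γ)` of degree
`p` satisfies `qx = y + pm` with `y ∈ M(Γ)` (`exists_nsmul_eq_add`, which uses normality), and a
weight argument (`isIntegral_of_pow_eq_add_sum`) shows that `m`, hence every monomial, is integral
modulo `f`. Thus only finitely many maximal ideals over `𝔪S` contain `f`.

These finitely many ideals are treated one at a time by moves that change nothing modulo the others
(`exists_rel_comaximal`). In the end no maximal ideal over `𝔪S` contains both chosen entries, one of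
which is monic. By lying over, the ideal they generate meets the image of `T \ 𝔪`, so it is the unit
ideal over `S_𝔪` (`exists_rel_comaximal_localized`).

Both groups are handled together through `IsMoveRel`. They differ only in how an entry reaches its
partner in the same pair: the symplectic group has generators for this, the orthogonal group makes a
detour through a third pair (hence `n ≥ 3`), and at the end isotropy kills the partner of the entry
`1`. -/

theorem sig_sig (i : Fin (2 * n)) : sig (sig i) = i := by
  ext
  simp only [sig]
  split_ifs <;> omega

theorem sig_ne (i : Fin (2 * n)) : sig i ≠ i := by
  intro h
  have := congrArg Fin.val h
  simp only [sig] at this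
  split_ifs at this <;> omega

theorem sig_lt_sig {i j : Fin (2 * n)} (h : i < j) (hs : sig i ≠ j) : sig i < sig j := by
  have h1 : (i : ℕ) < j := h
  have h2 : (sig i : ℕ) ≠ j := fun e => hs (Fin.ext e)
  change (sig i : ℕ) < sig j
  simp only [sig] at h2 ⊢
  split_ifs at h2 ⊢ <;> omega

theorem sig_eq_comm {i j : Fin (2 * n)} : sig i = j ↔ i = sig j :=
  ⟨fun h => by rw [← h, sig_sig], fun h => by rw [h, sig_sig]⟩

theorem sig_inj {i j : Fin (2 * n)} : sig i = sig j ↔ i = j := by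
  rw [sig_eq_comm, sig_sig]

/-- The row obtained from `u` by adding `l uᵢ` to `uⱼ` and subtracting `l c u_{σ(j)}`
from `u_{σ(i)}`. -/
def transvect (i j : Fin (2 * n)) (c l : A) (u : Fin (2 * n) → A) : Fin (2 * n) → A :=
  fun k => u k + (if k = j then u i * l else 0) - (if k = sig i then u (sig j) * (l * c) else 0)

/-- Relations between rows that contain the moves `transvect i j c` for some `c`, are reflexive
and transitive, and reflect the membership of all entries in an ideal. -/
structure IsMoveRel (r : (Fin (2 * n) → A) → (Fin (2 * n) → A) → Prop) : Prop where
  refl : ∀ u, r u u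
  trans : ∀ u v w, r u v → r v w → r u w
  move : ∀ i j, i ≠ j → sig i ≠ j → ∃ c, ∀ l u, r u (transvect i j c l u)
  mem_of_mem : ∀ u v, r u v → ∀ I : Ideal A, (∀ i, v i ∈ I) → ∀ i, u i ∈ I

/-- Relations between rows containing all moves that add a multiple of `uᵢ` to `u_{σ(i)}`. -/
def HasDiagMoves (r : (Fin (2 * n) → A) → (Fin (2 * n) → A) → Prop) : Prop :=
  ∀ i l u, r u (Function.update u (sig i) (u (sig i) + u i * l))

theorem OrbitRel.refl (E : Subgroup (GL (Fin (2 * n)) A)) (u : Fin (2 * n) → A) :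
    OrbitRel E u u :=
  ⟨1, E.one_mem, by simp⟩

theorem OrbitRel.trans {E : Subgroup (GL (Fin (2 * n)) A)} {u v w : Fin (2 * n) → A}
    (h : OrbitRel E u v) (h' : OrbitRel E v w) : OrbitRel E u w := by
  obtain ⟨g, hg, rfl⟩ := h
  obtain ⟨g', hg', rfl⟩ := h'
  exact ⟨g * g', E.mul_mem hg hg', by simp [Matrix.vecMul_vecMul]⟩

theorem OrbitRel.symm {E : Subgroup (GL (Fin (2 * n)) A)} {u v : Fin (2 * n) → A}
    (h : OrbitRel E u v) : OrbitRel E v u := by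
  obtain ⟨g, hg, rfl⟩ := h
  refine ⟨g⁻¹, E.inv_mem hg, ?_⟩
  rw [Matrix.vecMul_vecMul, ← Units.val_mul, mul_inv_cancel, Units.val_one, Matrix.vecMul_one]

theorem OrbitRel.mem_of_mem {E : Subgroup (GL (Fin (2 * n)) A)} {u v : Fin (2 * n) → A}
    (h : OrbitRel E u v) (I : Ideal A) (hv : ∀ i, v i ∈ I) (i : Fin (2 * n)) : u i ∈ I := by
  obtain ⟨g, -, rfl⟩ := h.symm
  simp only [vecMul, dotProduct]
  exact I.sum_mem fun j _ => I.mul_mem_right _ (hv j)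

theorem exists_generalLinear_of_sq_zero {N : Matrix (Fin (2 * n)) (Fin (2 * n)) A}
    (h : N * N = 0) : ∃ g : GL (Fin (2 * n)) A, (g : Matrix (Fin (2 * n)) (Fin (2 * n)) A) = 1 + N :=
  ⟨⟨1 + N, 1 - N, by simp [mul_sub, add_mul, h], by simp [mul_add, sub_mul, h]⟩, rfl⟩

theorem single_sub_single_sq {i j : Fin (2 * n)} (hij : i ≠ j) (x y : A) :
    (single i j x - single (sig j) (sig i) y) * (single i j x - single (sig j) (sig i) y) = 0 := by
  have h1 : j ≠ sig j := (sig_ne j).symm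
  have h2 : sig i ≠ i := sig_ne i
  have h3 : sig i ≠ sig j := by rwa [Ne, sig_inj]
  simp [sub_mul, mul_sub, h1, h2, h3, hij.symm]

theorem vecMul_transvect (i j : Fin (2 * n)) (c l : A) (u : Fin (2 * n) → A) :
    vecMul u (1 + single i j l - single (sig j) (sig i) (l * c)) = transvect i j c l u := by
  funext k
  simp only [vecMul_sub, vecMul_add, vecMul_one, Pi.sub_apply, Pi.add_apply, transvect]
  congr 2
  · simp [vecMul, dotProduct, single_apply, ite_and, eq_comm]
  · simp [vecMul, dotProduct, single_apply, ite_and, eq_comm]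

/-- The generators require `i < j`. For `i > j` the pair `(σ(j), σ(i))` is increasing and gives the
same matrix; the signs cancel because `k + σ(k)` is always odd. -/
theorem se_swap (i j : Fin (2 * n)) (l : A) :
    se (sig j) (sig i) (-(l * (-1) ^ ((i : ℕ) + (j : ℕ)))) = se i j l := by
  have hpar : ∀ k : Fin (2 * n), ∃ e : ℕ, (sig k : ℕ) + k = 2 * e + 1 := by
    intro k
    simp only [sig]
    split_ifs with h
    · exact ⟨k, by omega⟩
    · exact ⟨k - 1, by omega⟩
  have h : (-1 : A) ^ ((i : ℕ) + (j : ℕ)) * (-1) ^ ((sig j : ℕ) + (sig i : ℕ)) = 1 := by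
    obtain ⟨e, he⟩ := hpar i
    obtain ⟨e', he'⟩ := hpar j
    rw [← pow_add, show (i : ℕ) + j + (sig j + sig i) = 2 * (e + e' + 1) by omega, pow_mul]
    simp
  simp only [se, sig_sig, neg_mul, mul_assoc, h, mul_one]
  rw [← Matrix.single_neg, ← Matrix.single_neg]
  abel

theorem oe_swap (i j : Fin (2 * n)) (l : A) : oe (sig j) (sig i) (-l) = oe i j l := by
  simp only [oe, sig_sig]
  rw [← Matrix.single_neg, ← Matrix.single_neg]
  abel

theorem exists_mem_ESp_se {i j : Fin (2 * n)} (hij : i ≠ j) (hs : sig i ≠ j) (l : A) :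
    ∃ g ∈ ESp A n, (g : Matrix (Fin (2 * n)) (Fin (2 * n)) A) = se i j l := by
  obtain ⟨g, hg⟩ := exists_generalLinear_of_sq_zero
    (single_sub_single_sq hij l (l * (-1) ^ ((i : ℕ) + (j : ℕ))))
  have hg' : (g : Matrix (Fin (2 * n)) (Fin (2 * n)) A) = se i j l := by rw [hg, se, add_sub_assoc]
  refine ⟨g, Subgroup.subset_closure (Or.inr ?_), hg'⟩
  rcases lt_or_gt_of_ne hij with h | h
  · exact ⟨i, j, l, h, hs, hg'⟩
  · refine ⟨sig j, sig i, -(l * (-1) ^ ((i : ℕ) + (j : ℕ))),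
      sig_lt_sig h (fun e => hs (sig_eq_comm.2 e.symm)), ?_, ?_⟩
    · rw [sig_sig]
      exact fun e => hs e.symm
    · rw [se_swap, hg']

theorem exists_mem_EO_oe {i j : Fin (2 * n)} (hij : i ≠ j) (hs : sig i ≠ j) (l : A) :
    ∃ g ∈ EO A n, (g : Matrix (Fin (2 * n)) (Fin (2 * n)) A) = oe i j l := by
  obtain ⟨g, hg⟩ := exists_generalLinear_of_sq_zero (single_sub_single_sq hij l l)
  have hg' : (g : Matrix (Fin (2 * n)) (Fin (2 * n)) A) = oe i j l := by rw [hg, oe, add_sub_assoc]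
  refine ⟨g, Subgroup.subset_closure ?_, hg'⟩
  rcases lt_or_gt_of_ne hij with h | h
  · exact ⟨i, j, l, h, hs, hg'⟩
  · refine ⟨sig j, sig i, -l, sig_lt_sig h (fun e => hs (sig_eq_comm.2 e.symm)), ?_, ?_⟩
    · rw [sig_sig]
      exact fun e => hs e.symm
    · rw [oe_swap, hg']

variable (A n) in
theorem isMoveRel_ESp : IsMoveRel (OrbitRel (ESp A n)) where
  refl := OrbitRel.refl _
  trans _ _ _ := OrbitRel.trans
  mem_of_mem _ _ := OrbitRel.mem_of_mem
  move i j hij hs := by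
    refine ⟨(-1) ^ ((i : ℕ) + (j : ℕ)), fun l u => ?_⟩
    obtain ⟨g, hg, hg'⟩ := exists_mem_ESp_se hij hs l
    exact ⟨g, hg, by rw [hg', se, vecMul_transvect]⟩

variable (A n) in
theorem isMoveRel_EO : IsMoveRel (OrbitRel (EO A n)) where
  refl := OrbitRel.refl _
  trans _ _ _ := OrbitRel.trans
  mem_of_mem _ _ := OrbitRel.mem_of_mem
  move i j hij hs := by
    refine ⟨1, fun l u => ?_⟩
    obtain ⟨g, hg, hg'⟩ := exists_mem_EO_oe hij hs l
    refine ⟨g, hg, ?_⟩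
    rw [hg', oe, ← vecMul_transvect, mul_one]

variable (A n) in
theorem hasDiagMoves_ESp : HasDiagMoves (OrbitRel (ESp A n)) := by
  intro i l u
  obtain ⟨g, hg⟩ := exists_generalLinear_of_sq_zero (N := single i (sig i) l)
    (by simp [sig_ne])
  refine ⟨g, Subgroup.subset_closure (Or.inl ⟨i, l, hg⟩), ?_⟩
  funext k
  rw [hg, vecMul_add, vecMul_one, Pi.add_apply, Function.update_apply]
  split_ifs with h
  · subst h
    simp [vecMul, dotProduct, single_apply]
  · simp [vecMul, dotProduct, Ne.symm h]

variable {B : Type*} [CommRing B]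

theorem OrbitRel.map (φ : A →+* B) {E : Subgroup (GL (Fin (2 * n)) A)}
    {E' : Subgroup (GL (Fin (2 * n)) B)} (h : E ≤ E'.comap (GeneralLinearGroup.map φ))
    {u v : Fin (2 * n) → A} (huv : OrbitRel E u v) : OrbitRel E' (φ ∘ u) (φ ∘ v) := by
  obtain ⟨g, hg, rfl⟩ := huv
  refine ⟨_, h hg, ?_⟩
  funext k
  simp [vecMul, dotProduct]

theorem ESp_le_comap (φ : A →+* B) : ESp A n ≤ (ESp B n).comap (GeneralLinearGroup.map φ) := by
  rw [ESp, Subgroup.closure_le]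
  rintro g (⟨i, l, hg⟩ | ⟨i, j, l, hij, hs, hg⟩)
  · refine Subgroup.subset_closure (Or.inl ⟨i, φ l, ?_⟩)
    change (g : Matrix (Fin (2 * n)) (Fin (2 * n)) A).map φ = _
    rw [hg, symplecticDiag, symplecticDiag, Matrix.map_add _ (map_add φ),
      Matrix.map_one _ (map_zero φ) (map_one φ), Matrix.map_single]
  · refine Subgroup.subset_closure (Or.inr ⟨i, j, φ l, hij, hs, ?_⟩)
    change (g : Matrix (Fin (2 * n)) (Fin (2 * n)) A).map φ = _
    rw [hg, se, se, Matrix.map_sub _ (map_sub φ), Matrix.map_add _ (map_add φ),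
      Matrix.map_one _ (map_zero φ) (map_one φ), Matrix.map_single, Matrix.map_single]
    simp

theorem EO_le_comap (φ : A →+* B) : EO A n ≤ (EO B n).comap (GeneralLinearGroup.map φ) := by
  rw [EO, Subgroup.closure_le]
  rintro g ⟨i, j, l, hij, hs, hg⟩
  refine Subgroup.subset_closure ⟨i, j, φ l, hij, hs, ?_⟩
  change (g : Matrix (Fin (2 * n)) (Fin (2 * n)) A).map φ = _
  rw [hg, oe, oe, Matrix.map_sub _ (map_sub φ), Matrix.map_add _ (map_add φ),
    Matrix.map_one _ (map_zero φ) (map_one φ), Matrix.map_single, Matrix.map_single]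

theorem dotProduct_psi (u : Fin (2 * n) → A) :
    u ⬝ᵥ (psi A n).mulVec u = ∑ i, u i * u (sig i) := by
  simp [dotProduct, mulVec, psi]

/-- The elementary orthogonal group preserves isotropic rows. -/
theorem isIsotropic_of_orbitRel {u v : Fin (2 * n) → A} (h : OrbitRel (EO A n) u v)
    (hu : IsIsotropic u) : IsIsotropic v := by
  -- Invariance of the form only has to be checked on the generators.
  have key : ∀ g ∈ EO A n, g.1 * psi A n * g.1ᵀ = psi A n := by
    intro g hg
    induction hg using Subgroup.closure_induction with
    | mem g hg =>
      obtain ⟨i, j, l, hij, hs, hg⟩ := hg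
      have hp : ∀ (a b : Fin (2 * n)) (x : A),
          single a b x * psi A n = single a (sig b) x := by
        intro a b x
        ext p q
        by_cases h : a = p
        · simp [mul_apply, single_apply, psi, h, sig_eq_comm]
        · simp [mul_apply, h]
      have hp' : ∀ (a b : Fin (2 * n)) (x : A),
          psi A n * single a b x = single (sig a) b x := by
        intro a b x
        ext p q
        have h' : sig p = a ↔ sig a = p := by rw [sig_eq_comm, eq_comm]
        by_cases h : b = q
        · simp [mul_apply, single_apply, psi, h, h']
        · simp [mul_apply, h]
      have h1 : i ≠ j := hij.ne
      rw [hg, oe, transpose_sub, transpose_add, transpose_one, transpose_single, transpose_single]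
      simp only [sub_mul, add_mul, mul_sub, mul_add, one_mul, mul_one, hp, hp', sig_sig]
      simp [h1, h1.symm, sig_ne, (sig_ne _).symm, sig_inj]
    | one => simp
    | mul g h _ _ hg hh =>
      rw [Units.val_mul, transpose_mul]
      calc _ = g.1 * (h.1 * psi A n * h.1ᵀ) *
            g.1ᵀ := by simp only [Matrix.mul_assoc]
        _ = _ := by rw [hh, hg]
    | inv g _ hg =>
      have h1 : g⁻¹.1 * g.1 = 1 := by
        rw [← Units.val_mul, inv_mul_cancel, Units.val_one]
      have h2 : g.1ᵀ * g⁻¹.1ᵀ = 1 := by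
        rw [← transpose_mul, h1, transpose_one]
      calc _ = g⁻¹.1 * (g.1 * psi A n *
            g.1ᵀ) * g⁻¹.1ᵀ := by rw [hg]
        _ = (g⁻¹.1 * g.1) * psi A n *
            (g.1ᵀ * g⁻¹.1ᵀ) := by
          simp only [Matrix.mul_assoc]
        _ = _ := by rw [h1, h2, one_mul, mul_one]
  obtain ⟨g, hg, rfl⟩ := h
  rw [IsIsotropic, ← mulVec_transpose, mulVec_mulVec] at *
  rw [mulVec_transpose, ← dotProduct_mulVec, mulVec_mulVec, ← Matrix.mul_assoc, key g hg]
  exact hu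

end Groups

/-! ### Making two entries comaximal at finitely many maximal ideals. -/

section Reduction

variable {n : ℕ} {S : Type*} [CommRing S]

/-- A move with parameter `l` is invisible modulo every ideal containing `l`, so work at one maximal
ideal does not disturb the others. -/
theorem dvd_transvect_sub (i j : Fin (2 * n)) (c l : S) (u : Fin (2 * n) → S) (k : Fin (2 * n)) :
    l ∣ transvect i j c l u k - u k := by
  simp only [transvect]
  split_ifs
  · exact ⟨u i - u (sig j) * c, by ring⟩
  · exact ⟨u i, by ring⟩
  · exact ⟨-(u (sig j) * c), by ring⟩
  · exact ⟨0, by ring⟩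

theorem transvect_of_ne {i j k : Fin (2 * n)} (hj : k ≠ j) (hi : k ≠ sig i) (c l : S)
    (u : Fin (2 * n) → S) : transvect i j c l u k = u k := by
  simp [transvect, hj, hi]

theorem transvect_right {i j : Fin (2 * n)} (hs : sig i ≠ j) (c l : S) (u : Fin (2 * n) → S) :
    transvect i j c l u j = u j + u i * l := by
  simp [transvect, hs.symm]

theorem transvect_sig {i j : Fin (2 * n)} (hs : sig i ≠ j) (c l : S) (u : Fin (2 * n) → S) :
    transvect i j c l u (sig i) = u (sig i) - u (sig j) * (l * c) := by
  simp [transvect, hs]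

theorem add_mul_notMem {I : Ideal S} [I.IsPrime] {x y e : S} (hx : x ∈ I) (hy : y ∉ I)
    (he : e ∉ I) : x + y * e ∉ I := fun h =>
  (Ideal.IsPrime.mem_or_mem ‹_› ((Ideal.add_mem_iff_right I hx).1 h)).elim hy he

theorem exists_notMem_forall_mem (F : Finset (Ideal S)) (hF : ∀ I ∈ F, I.IsMaximal) {I : Ideal S}
    (hI : I ∈ F) : ∃ e ∉ I, ∀ J ∈ F, J ≠ I → e ∈ J := by
  classical
  have h : ∀ J : Ideal S, ∃ x ∉ I, J ∈ F → J ≠ I → x ∈ J := by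
    intro J
    by_cases hJ : J ∈ F ∧ J ≠ I
    · obtain ⟨x, hx, hx'⟩ := Set.not_subset.1
        (fun hle : (J : Set S) ⊆ I => hJ.2 ((hF J hJ.1).eq_of_le (hF I hI).ne_top hle))
      exact ⟨x, hx', fun _ _ => hx⟩
    · exact ⟨1, (Ideal.ne_top_iff_one I).1 (hF I hI).ne_top, fun h h' => absurd ⟨h, h'⟩ hJ⟩
  choose x hx hx' using h
  have := (hF I hI).isPrime
  refine ⟨∏ J ∈ F.erase I, x J, fun hmem => ?_, fun J hJ hne => ?_⟩
  · obtain ⟨J, -, hJ⟩ := (Ideal.IsPrime.prod_mem_iff).1 hmem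
    exact hx J hJ
  · exact Ideal.mem_of_dvd J (Finset.dvd_prod_of_mem x (Finset.mem_erase.2 ⟨hne, hJ⟩))
      (hx' J hJ hne)

/-- Finitely many maximal ideals can be treated one at a time. -/
theorem exists_rel_forall_mem {ι : Type*} {r : (ι → S) → (ι → S) → Prop} (hrefl : ∀ u, r u u)
    (htrans : ∀ u v w, r u v → r v w → r u w) (F : Finset (Ideal S))
    (hF : ∀ I ∈ F, I.IsMaximal) (Q P : (ι → S) → Ideal S → Prop)
    (hQ : ∀ I u v, (∀ i, v i - u i ∈ I) → Q u I → Q v I)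
    (hP : ∀ I u v, (∀ i, v i - u i ∈ I) → P u I → P v I)
    (step : ∀ I ∈ F, ∀ e ∉ I, ∀ u, Q u I → ∃ v, r u v ∧ (∀ i, e ∣ v i - u i) ∧ P v I)
    (u : ι → S) (hu : ∀ I ∈ F, Q u I) : ∃ v, r u v ∧ ∀ I ∈ F, P v I := by
  classical
  -- `G` collects the ideals already treated: `P` has been achieved on `G`, while the precondition
  -- `Q` survives on the rest.
  suffices h : ∀ G : Finset (Ideal S), G ⊆ F →
      ∃ v, r u v ∧ (∀ I ∈ G, P v I) ∧ ∀ I ∈ F, I ∉ G → Q v I by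
    obtain ⟨v, h1, h2, -⟩ := h F subset_rfl
    exact ⟨v, h1, h2⟩
  intro G
  induction G using Finset.induction_on with
  | empty => exact fun _ => ⟨u, hrefl u, by simp, fun I hI _ => hu I hI⟩
  | insert I G hIG ih =>
    intro hG
    have hIF := hG (Finset.mem_insert_self I G)
    obtain ⟨v, huv, hv, hv'⟩ := ih (fun J hJ => hG (Finset.mem_insert_of_mem hJ))
    obtain ⟨e, he, he'⟩ := exists_notMem_forall_mem F hF hIF
    obtain ⟨w, hvw, hdvd, hw⟩ := step I hIF e he v (hv' I hIF hIG)
    have hcong : ∀ J ∈ F, J ≠ I → ∀ i, w i - v i ∈ J := fun J hJ hne i =>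
      Ideal.mem_of_dvd J (hdvd i) (he' J hJ hne)
    refine ⟨w, htrans _ _ _ huv hvw, fun J hJ => ?_, fun J hJ hJ' => ?_⟩
    · rcases Finset.mem_insert.1 hJ with rfl | hJ
      · exact hw
      · exact hP J v w (hcong J (hG (Finset.mem_insert_of_mem hJ))
          (fun h => hIG (h ▸ hJ))) (hv J hJ)
    · rw [Finset.mem_insert, not_or] at hJ'
      exact hQ J v w (hcong J hJ hJ'.1) (hv' J hJ hJ'.2)

theorem notMem_of_sub_mem {I : Ideal S} {x y : S} (h : y - x ∈ I) (hx : x ∉ I) : y ∉ I :=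
  fun hy => hx (by simpa using I.sub_mem hy h)

variable {r : (Fin (2 * n) → S) → (Fin (2 * n) → S) → Prop}

/-- Room for moves avoiding the pairs of `a` and `z`. -/
def HasRoom (r : (Fin (2 * n) → S) → (Fin (2 * n) → S) → Prop) (a z : Fin (2 * n)) : Prop :=
  HasDiagMoves r ∨ ∃ b, b ≠ a ∧ b ≠ sig a ∧ b ≠ z ∧ b ≠ sig z

/-- If the entries at `σ(a)` and `z` both lie in `I`, an entry outside `I` is added, times `e`, to
the one at `z`. Only the source `σ(z)` is not covered by a single move of `IsMoveRel`. It needs a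
diagonal move, or a detour through `b`, whose first half changes the entry at `z` only by a multiple
of the entry at `σ(b)`, which may be assumed to lie in `I`. -/
theorem exists_step_off_pair (hr : IsMoveRel r) {a z : Fin (2 * n)} (haz : z ≠ a)
    (hsaz : z ≠ sig a) (hroom : HasRoom r a z) (I : Ideal S) [I.IsPrime] (e : S) (he : e ∉ I)
    (u : Fin (2 * n) → S) (hu : ∃ i, i ≠ a ∧ u i ∉ I) :
    ∃ v, (r u v ∧ v a = u a) ∧ (∀ i, e ∣ v i - u i) ∧ (v (sig a) ∉ I ∨ v z ∉ I) := by
  by_cases h1 : u (sig a) ∉ I ∨ u z ∉ I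
  · exact ⟨u, ⟨hr.refl u, rfl⟩, fun i => by simp, h1⟩
  push Not at h1
  obtain ⟨h1, hz⟩ := h1
  have direct : ∀ i, i ≠ a → i ≠ sig z → u i ∉ I →
      ∃ v, (r u v ∧ v a = u a) ∧ (∀ i, e ∣ v i - u i) ∧ (v (sig a) ∉ I ∨ v z ∉ I) := by
    intro i hia hiz hi
    have hne : i ≠ z := fun h => hi (h ▸ hz)
    have hnea : i ≠ sig a := fun h => hi (h ▸ h1)
    have hs : sig i ≠ z := fun h => hiz (sig_eq_comm.1 h)
    obtain ⟨c, hc⟩ := hr.move i z hne hs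
    refine ⟨_, ⟨hc e u, transvect_of_ne haz.symm (fun h => hnea ?_) _ _ _⟩,
      dvd_transvect_sub _ _ _ _ _, Or.inr ?_⟩
    · exact sig_eq_comm.1 h.symm
    · rw [transvect_right hs]
      exact add_mul_notMem hz hi he
  obtain ⟨i, hia, hi⟩ := hu
  by_cases hiz : i = sig z
  swap
  · exact direct i hia hiz hi
  subst hiz
  rcases hroom with hdiag | ⟨b, hba, hbsa, hbz, hbsz⟩
  · have h := hdiag (sig z) e u
    rw [sig_sig] at h
    refine ⟨_, ⟨h, Function.update_of_ne haz.symm _ _⟩, fun k => ?_, Or.inr ?_⟩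
    · by_cases hk : k = z
      · subst hk
        simp
      · simp [hk]
    · simpa using add_mul_notMem hz hi he
  by_cases hb : u b ∉ I
  · exact direct b hba hbsz hb
  by_cases hsb : u (sig b) ∉ I
  · exact direct (sig b) (fun h => hbsa (sig_eq_comm.1 h)) (fun h => hbz (sig_inj.1 h)) hsb
  push Not at hb hsb
  have hs1 : sig (sig z) ≠ b := by rw [sig_sig]; exact hbz.symm
  have hs2 : sig b ≠ z := fun h => hbsz (sig_eq_comm.1 h)
  obtain ⟨c, hc⟩ := hr.move (sig z) b hbsz.symm hs1
  obtain ⟨c', hc'⟩ := hr.move b z hbz hs2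
  refine ⟨_, ⟨hr.trans _ _ _ (hc e u) (hc' e _), ?_⟩, fun k => ?_, Or.inr ?_⟩
  · rw [transvect_of_ne haz.symm (fun h => hbsa (sig_eq_comm.1 h.symm)),
      transvect_of_ne hba.symm (by rw [sig_sig]; exact haz.symm)]
  · have := dvd_add (dvd_transvect_sub b z c' e (transvect (sig z) b c e u) k)
      (dvd_transvect_sub (sig z) b c e u k)
    simpa using this
  · rw [transvect_right hs2, transvect_right hs1]
    refine add_mul_notMem ?_ (add_mul_notMem hb hi he) he
    have := transvect_sig hs1 c e u
    rw [sig_sig] at this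
    rw [this]
    exact I.sub_mem hz (I.mul_mem_right _ hsb)

/-- The counterpart inside the pair of `a`: an entry outside `I` is carried from `σ(a)` to `a`,
again directly or through `b`, and the entry at `z` is kept. -/
theorem exists_step_in_pair (hr : IsMoveRel r) {a z : Fin (2 * n)} (haz : z ≠ a)
    (hsaz : z ≠ sig a) (hroom : HasRoom r a z) (I : Ideal S) [I.IsPrime] (e : S) (he : e ∉ I)
    (u : Fin (2 * n) → S) (hu : u a ∉ I ∨ u (sig a) ∉ I) :
    ∃ v, (r u v ∧ v z = u z) ∧ (∀ i, e ∣ v i - u i) ∧ v a ∉ I := by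
  by_cases ha : u a ∉ I
  · exact ⟨u, ⟨hr.refl u, rfl⟩, fun i => by simp, ha⟩
  replace hu := hu.resolve_left ha
  push Not at ha
  rcases hroom with hdiag | ⟨b, hba, hbsa, hbz, hbsz⟩
  · have h := hdiag (sig a) e u
    rw [sig_sig] at h
    refine ⟨_, ⟨h, Function.update_of_ne haz _ _⟩, fun k => ?_, ?_⟩
    · by_cases hk : k = a
      · subst hk
        simp
      · simp [hk]
    · simpa using add_mul_notMem ha hu he
  have direct : ∀ i, i ≠ a → i ≠ sig a → i ≠ sig z → u i ∉ I →
      ∃ v, (r u v ∧ v z = u z) ∧ (∀ i, e ∣ v i - u i) ∧ v a ∉ I := by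
    intro i hia hisa hisz hi
    have hs : sig i ≠ a := fun h => hisa (sig_eq_comm.1 h)
    obtain ⟨c, hc⟩ := hr.move i a hia hs
    refine ⟨_, ⟨hc e u, transvect_of_ne haz (fun h => hisz ?_) _ _ _⟩,
      dvd_transvect_sub _ _ _ _ _, ?_⟩
    · exact sig_eq_comm.1 h.symm
    · rw [transvect_right hs]
      exact add_mul_notMem ha hi he
  by_cases hb : u b ∉ I
  · exact direct b hba hbsa hbsz hb
  by_cases hsb : u (sig b) ∉ I
  · exact direct (sig b) (fun h => hbsa (sig_eq_comm.1 h)) (fun h => hba (sig_inj.1 h))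
      (fun h => hbz (sig_inj.1 h)) hsb
  push Not at hb hsb
  have hs1 : sig (sig a) ≠ b := by rw [sig_sig]; exact hba.symm
  have hs2 : sig b ≠ a := fun h => hbsa (sig_eq_comm.1 h)
  obtain ⟨c, hc⟩ := hr.move (sig a) b hbsa.symm hs1
  obtain ⟨c', hc'⟩ := hr.move b a hba hs2
  refine ⟨_, ⟨hr.trans _ _ _ (hc e u) (hc' e _), ?_⟩, fun k => ?_, ?_⟩
  · rw [transvect_of_ne haz (fun h => hbsz (sig_eq_comm.1 h.symm)),
      transvect_of_ne hbz.symm (by rw [sig_sig]; exact haz)]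
  · have := dvd_add (dvd_transvect_sub b a c' e (transvect (sig a) b c e u) k)
      (dvd_transvect_sub (sig a) b c e u k)
    simpa using this
  · rw [transvect_right hs2, transvect_right hs1]
    refine add_mul_notMem ?_ (add_mul_notMem hb hu he) he
    have := transvect_sig hs1 c e u
    rw [sig_sig] at this
    rw [this]
    exact I.sub_mem ha (I.mul_mem_right _ hsb)

/-- A unimodular row with an entry in a set `𝒢` of "monic" elements can be moved to a row two
entries of which, one of them still in `𝒢`, are comaximal modulo `I₀`. -/
theorem exists_rel_comaximal (hr : IsMoveRel r) {a z : Fin (2 * n)} (haz : z ≠ a)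
    (hsaz : z ≠ sig a) (hroom : HasRoom r a z) (I₀ : Ideal S) (𝒢 : Set S)
    (hmul : ∀ f ∈ 𝒢, ∀ g ∈ 𝒢, f * g ∈ 𝒢) (hadd : ∀ f ∈ 𝒢, ∀ x, ∃ y, x + f * y ∈ 𝒢)
    (hfin : ∀ f ∈ 𝒢, {I : Ideal S | I.IsMaximal ∧ f ∈ I ∧ I₀ ≤ I}.Finite)
    (u : Fin (2 * n) → S) (hu : ∀ I : Ideal S, I.IsMaximal → ∃ i, u i ∉ I) (hz : u z ∈ 𝒢) :
    ∃ v, r u v ∧ v z ∈ 𝒢 ∧ ∀ I : Ideal S, I.IsMaximal → v z ∈ I → I₀ ≤ I → v a ∉ I := by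
  have hsza : sig z ≠ a := fun h => hsaz (sig_eq_comm.1 h)
  -- Once the entry at `a` is monic too, only finitely many maximal ideals over `I₀` contain it.
  obtain ⟨u₁, h₁, ha₁, hu₁⟩ : ∃ v, r u v ∧ v a ∈ 𝒢 ∧
      ∀ I : Ideal S, I.IsMaximal → ∃ i, v i ∉ I := by
    obtain ⟨y, hy⟩ := hadd _ hz (u a)
    obtain ⟨c, hc⟩ := hr.move z a haz hsza
    refine ⟨_, hc y u, by rwa [transvect_right hsza], fun I hI => ?_⟩
    by_contra! h
    obtain ⟨i, hi⟩ := hu I hI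
    exact hi (hr.mem_of_mem _ _ (hc y u) I h i)
  -- At each of these ideals the entry at `σ(a)` or `z` is made nonzero, with the entry at `a`
  -- untouched.
  obtain ⟨u₂, ⟨h₂, ha₂⟩, hu₂⟩ := exists_rel_forall_mem
    (r := fun v w => r v w ∧ w a = v a) (fun v => ⟨hr.refl v, rfl⟩)
    (fun v w x h h' => ⟨hr.trans _ _ _ h.1 h'.1, h'.2.trans h.2⟩) (hfin _ ha₁).toFinset
    (fun I hI => ((hfin _ ha₁).mem_toFinset.1 hI).1) (fun v I => ∃ i, i ≠ a ∧ v i ∉ I)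
    (fun v I => v (sig a) ∉ I ∨ v z ∉ I)
    (fun I v w h ⟨i, hi, hv⟩ => ⟨i, hi, notMem_of_sub_mem (h i) hv⟩)
    (fun I v w h hv => hv.imp (notMem_of_sub_mem (h _)) (notMem_of_sub_mem (h _)))
    (fun I hI e he v hv => by
      have := ((hfin _ ha₁).mem_toFinset.1 hI).1.isPrime
      exact exists_step_off_pair hr haz hsaz hroom I e he v hv) u₁
    (fun I hI => by
      obtain ⟨hmax, hmem, -⟩ := (hfin _ ha₁).mem_toFinset.1 hI
      obtain ⟨i, hi⟩ := hu₁ I hmax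
      exact ⟨i, fun h => hi (h ▸ hmem), hi⟩)
  obtain ⟨u₃, h₃, hz₃, hu₃⟩ : ∃ v, r u₂ v ∧ v z ∈ 𝒢 ∧
      ∀ I : Ideal S, I.IsMaximal → v z ∈ I → I₀ ≤ I → v a ∉ I ∨ v (sig a) ∉ I := by
    -- A multiple of the square of the entry at `a` makes the entry at `z` monic again. One factor
    -- goes into the parameter of the move, so the side effect at `σ(a)` vanishes modulo every ideal
    -- containing the entry at `a`.
    obtain ⟨y, hy⟩ := hadd _ (hmul _ ha₁ _ ha₁) (u₂ z)
    obtain ⟨c, hc⟩ := hr.move a z haz.symm hsaz.symm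
    refine ⟨_, hc (u₁ a * y) u₂, ?_, fun I hI => ?_⟩
    · rwa [transvect_right hsaz.symm, ha₂, ← mul_assoc]
    · rw [transvect_right hsaz.symm, transvect_sig hsaz.symm,
        transvect_of_ne haz.symm (sig_ne a).symm, ha₂]
      intro hzI hI₀
      by_cases haI : u₁ a ∈ I
      · right
        have hz₂ : u₂ z ∈ I := (Ideal.add_mem_iff_left I (I.mul_mem_right _ haI)).1 hzI
        have := (hu₂ I ((hfin _ ha₁).mem_toFinset.2 ⟨hI, haI, hI₀⟩)).resolve_right
          (fun h => h hz₂)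
        refine notMem_of_sub_mem (x := u₂ (sig a)) ?_ this
        rw [sub_sub_cancel_left]
        exact I.neg_mem (I.mul_mem_left _ (I.mul_mem_right _ (I.mul_mem_right _ haI)))
      · exact Or.inl haI
  -- The new entry at `z` again lies in finitely many relevant ideals; there the nonzero entry of
  -- the pair of `a` is brought to `a`.
  obtain ⟨u₄, ⟨h₄, hz₄⟩, hu₄⟩ := exists_rel_forall_mem
    (r := fun v w => r v w ∧ w z = v z) (fun v => ⟨hr.refl v, rfl⟩)
    (fun v w x h h' => ⟨hr.trans _ _ _ h.1 h'.1, h'.2.trans h.2⟩) (hfin _ hz₃).toFinset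
    (fun I hI => ((hfin _ hz₃).mem_toFinset.1 hI).1) (fun v I => v a ∉ I ∨ v (sig a) ∉ I)
    (fun v I => v a ∉ I)
    (fun I v w h hv => hv.imp (notMem_of_sub_mem (h _)) (notMem_of_sub_mem (h _)))
    (fun I v w h hv => notMem_of_sub_mem (h _) hv)
    (fun I hI e he v hv => by
      have := ((hfin _ hz₃).mem_toFinset.1 hI).1.isPrime
      exact exists_step_in_pair hr haz hsaz hroom I e he v hv) u₃
    (fun I hI => by
      obtain ⟨hmax, hmem, hle⟩ := (hfin _ hz₃).mem_toFinset.1 hI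
      exact hu₃ I hmax hmem hle)
  refine ⟨u₄, hr.trans _ _ _ h₁ (hr.trans _ _ _ h₂ (hr.trans _ _ _ h₃ h₄)), hz₄ ▸ hz₃,
    fun I hI hzI hle => hu₄ I ((hfin _ hz₃).mem_toFinset.2 ⟨hI, hz₄ ▸ hzI, hle⟩)⟩

end Reduction

/-! ### Clearing a row with two comaximal entries. -/

section Clearing

variable {n : ℕ} {A : Type*} [CommRing A] {r : (Fin (2 * n) → A) → (Fin (2 * n) → A) → Prop}

/-- A row with an entry `1` in position `p` can be cleared outside `p` and `σ(p)`. -/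
theorem exists_rel_clear (hr : IsMoveRel r) (p : Fin (2 * n)) (u : Fin (2 * n) → A)
    (hu : u p = 1) :
    ∃ v, r u v ∧ v p = 1 ∧ ∀ i, i ≠ p → i ≠ sig p → v i = 0 := by
  suffices h : ∀ s : Finset (Fin (2 * n)), ∃ v, r u v ∧ v p = 1 ∧
      ∀ i ∈ s, i ≠ p → i ≠ sig p → v i = 0 by
    obtain ⟨v, h1, h2, h3⟩ := h Finset.univ
    exact ⟨v, h1, h2, fun i => h3 i (Finset.mem_univ i)⟩
  intro s
  induction s using Finset.induction_on with
  | empty => exact ⟨u, hr.refl u, hu, by simp⟩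
  | insert j s hj ih =>
    obtain ⟨v, huv, hp, hv⟩ := ih
    by_cases hjp : j = p ∨ j = sig p
    · refine ⟨v, huv, hp, fun i hi h1 h2 => ?_⟩
      rcases Finset.mem_insert.1 hi with rfl | hi
      · exact (hjp.elim h1 h2).elim
      · exact hv i hi h1 h2
    push Not at hjp
    -- This move changes only positions `j` and `σ(p)`, so cleared entries stay zero.
    obtain ⟨c, hc⟩ := hr.move p j hjp.1.symm hjp.2.symm
    refine ⟨_, hr.trans _ _ _ huv (hc (-v j) v), ?_, fun i hi h1 h2 => ?_⟩
    · rw [transvect_of_ne hjp.1.symm (sig_ne p).symm, hp]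
    · by_cases hij : i = j
      · subst hij
        rw [transvect_right hjp.2.symm, hp]
        ring
      · rw [transvect_of_ne hij h2]
        exact hv i ((Finset.mem_insert.1 hi).resolve_left hij) h1 h2

/-- A standard basis row can be moved to any other one outside its pair. -/
theorem rel_single_single (hr : IsMoveRel r) {p q : Fin (2 * n)} (hpq : p ≠ q) (hs : sig p ≠ q)
    (u v : Fin (2 * n) → A) (hup : u p = 1) (hu : ∀ i, i ≠ p → u i = 0) (hvq : v q = 1)
    (hv : ∀ i, i ≠ q → v i = 0) : r u v := by
  have hs' : sig q ≠ p := fun h => hs (sig_eq_comm.1 h).symm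
  obtain ⟨c, hc⟩ := hr.move p q hpq hs
  obtain ⟨c', hc'⟩ := hr.move q p hpq.symm hs'
  have hsq : u (sig q) = 0 := hu _ hs'
  -- Add the entry at `p` to the one at `q`, then subtract back; both side effects are multiples of
  -- zero entries.
  convert hr.trans _ _ _ (hc 1 u) (hc' (-1) _) using 1
  funext k
  have hq : transvect p q c 1 u q = 1 := by
    rw [transvect_right hs, hup, hu _ hpq.symm]
    ring
  by_cases hkp : k = p
  · subst hkp
    rw [transvect_right hs', hq, transvect_of_ne hpq (sig_ne k).symm, hup, hv _ hpq]
    ring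
  · have : transvect q p c' (-1) (transvect p q c 1 u) k = transvect p q c 1 u k := by
      simp [transvect, hkp]
      intro hk
      simp [hu _ (sig_ne p), hs, hsq]
    rw [this]
    by_cases hkq : k = q
    · subst hkq
      rw [hq, hvq]
    · rw [hv k hkq]
      simp [transvect, hkq, hu k hkp, hsq]

/-- The relation `u a * x + u z * y = 1`, scaled by `1 - u (sig z)`, says which multiples of the
entries at `a` and `z` turn the entry at `σ(z)` into `1`. After clearing, a diagonal move removes
the remaining entry at `z`. -/
theorem rel_of_hasDiagMoves (hr : IsMoveRel r) (hdiag : HasDiagMoves r) {a z : Fin (2 * n)}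
    (haz : z ≠ a) (hsaz : z ≠ sig a) (u : Fin (2 * n) → A) (x y : A)
    (hu : u a * x + u z * y = 1) (v : Fin (2 * n) → A) (hva : v a = 1)
    (hv : ∀ i, i ≠ a → v i = 0) : r u v := by
  have hs : sig a ≠ sig z := fun h => haz.symm (sig_inj.1 h)
  have hpa : sig z ≠ a := fun h => hsaz (sig_eq_comm.1 h)
  obtain ⟨c, hc⟩ := hr.move a (sig z) hpa.symm hs
  set u₁ := transvect a (sig z) c (x * (1 - u (sig z))) u with hu₁
  have h₁ : r u u₁ := hc _ u
  have h₂ := hdiag z (y * (1 - u (sig z))) u₁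
  obtain ⟨w, h₃, hw, hw'⟩ := exists_rel_clear hr (sig z)
    (Function.update u₁ (sig z) (u₁ (sig z) + u₁ z * (y * (1 - u (sig z))))) (by
    rw [Function.update_self, hu₁, transvect_right hs, transvect_of_ne (sig_ne z).symm hsaz]
    linear_combination (1 - u (sig z)) * hu)
  have h₄ := hdiag (sig z) (-w z) w
  rw [sig_sig, hw, one_mul, add_neg_cancel] at h₄
  rw [sig_sig] at hw'
  refine hr.trans _ _ _ h₁ (hr.trans _ _ _ h₂ (hr.trans _ _ _ h₃ (hr.trans _ _ _ h₄
    (rel_single_single hr hpa (by rwa [sig_sig]) _ _ ?_ (fun i hi => ?_) hva hv))))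
  · rwa [Function.update_of_ne (sig_ne z)]
  · by_cases hiz : i = z
    · rw [hiz, Function.update_self]
    · rw [Function.update_of_ne hiz]
      exact hw' i hi hiz

/-- Without diagonal moves the `1` is built at `b`, outside both pairs. After clearing, isotropy
reads `2 * w (sig b) = 0`, which removes the last unwanted entry. -/
theorem rel_of_isIsotropic (hr : IsMoveRel r) {a z b : Fin (2 * n)}
    (hsaz : z ≠ sig a) (hba : b ≠ a) (hbsa : b ≠ sig a) (hbz : b ≠ z) (hbsz : b ≠ sig z)
    (u : Fin (2 * n) → A) (x y : A) (hu : u a * x + u z * y = 1)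
    (hiso : ∀ w, r u w → IsIsotropic w) (h2 : (2 : A) ∈ nonZeroDivisors A)
    (v : Fin (2 * n) → A) (hva : v a = 1) (hv : ∀ i, i ≠ a → v i = 0) : r u v := by
  obtain ⟨c, hc⟩ := hr.move a b hba.symm hbsa.symm
  obtain ⟨c', hc'⟩ := hr.move z b hbz.symm hbsz.symm
  set u₁ := transvect a b c (x * (1 - u b)) u with hu₁
  have h₁ : r u u₁ := hc _ u
  have h₂ := hc' (y * (1 - u b)) u₁
  obtain ⟨w, h₃, hw, hw'⟩ := exists_rel_clear hr b
    (transvect z b c' (y * (1 - u b)) u₁) (by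
    rw [transvect_right hbsz.symm, hu₁, transvect_right hbsa.symm, transvect_of_ne hbz.symm hsaz]
    linear_combination (1 - u b) * hu)
  have huw := hr.trans _ _ _ h₁ (hr.trans _ _ _ h₂ h₃)
  have hsb : w (sig b) = 0 := by
    have h := hiso w huw
    rw [IsIsotropic, dotProduct_psi, ← Finset.sum_subset (Finset.subset_univ {b, sig b}),
      Finset.sum_pair (sig_ne b).symm, sig_sig, hw, one_mul, mul_one, ← two_mul] at h
    · exact (mul_left_mem_nonZeroDivisors_eq_zero_iff h2).1 h
    · intro i _ hi
      simp only [Finset.mem_insert, Finset.mem_singleton, not_or] at hi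
      rw [hw' i hi.1 hi.2, zero_mul]
  refine hr.trans _ _ _ huw (rel_single_single hr hba (fun h => hbsa (sig_eq_comm.1 h)) _ _ hw
    (fun i hi => ?_) hva hv)
  by_cases hib : i = sig b
  · rw [hib, hsb]
  · exact hw' i hi hib

end Clearing

/-! ### Maximal ideals over `𝔪` in integral quotients. -/

section Integral

variable {T S : Type*} [CommRing T] [CommRing S] [Algebra T S]

/-- `S ⧸ J` is a finite `T`-module, so it has finitely many primes over `𝔪`; maximality of `𝔪` makes
the ideals in question lie over it. -/
theorem finite_setOf_isMaximal (hft : Algebra.FiniteType T S) (𝔪 : Ideal T) [𝔪.IsMaximal] (J : Ideal S)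
    (hint : Algebra.IsIntegral T (S ⧸ J)) :
    {I : Ideal S | I.IsMaximal ∧ J ≤ I ∧ 𝔪.map (algebraMap T S) ≤ I}.Finite := by
  have : Algebra.FiniteType T (S ⧸ J) := Algebra.FiniteType.trans hft inferInstance
  have : Module.Finite T (S ⧸ J) := Algebra.IsIntegral.finite
  refine ((Algebra.QuasiFinite.finite_primesOver (S := S ⧸ J) 𝔪).image
    (Ideal.comap (Ideal.Quotient.mk J))).subset ?_
  rintro I ⟨hI, hJ, hm⟩
  have hcomap : (I.map (Ideal.Quotient.mk J)).comap (Ideal.Quotient.mk J) = I := by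
    rw [Ideal.comap_map_of_surjective _ Ideal.Quotient.mk_surjective, ← RingHom.ker_eq_comap_bot,
      Ideal.mk_ker, sup_of_le_left hJ]
  refine ⟨I.map (Ideal.Quotient.mk J), ⟨?_, ⟨?_⟩⟩, hcomap⟩
  · exact Ideal.map_isPrime_of_surjective (H := hI.isPrime) Ideal.Quotient.mk_surjective
      (by rwa [Ideal.mk_ker])
  · rw [Ideal.under_def, IsScalarTower.algebraMap_eq T S (S ⧸ J), ← Ideal.comap_comap]
    change 𝔪 = ((I.map (Ideal.Quotient.mk J)).comap (Ideal.Quotient.mk J)).comap (algebraMap T S)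
    rw [hcomap]
    refine ‹𝔪.IsMaximal›.eq_of_le ?_ (Ideal.map_le_iff_le_comap.1 hm)
    exact (Ideal.comap_isPrime (H := hI.isPrime) (algebraMap T S) I).ne_top

/-- An ideal `J` that is comaximal to `𝔪S`, with `S/J` integral over `T`, meets the image of the
complement of `𝔪`. -/
theorem exists_algebraMap_mem (𝔪 : Ideal T) [𝔪.IsMaximal] (J : Ideal S)
    (hint : Algebra.IsIntegral T (S ⧸ J))
    (h : ∀ I : Ideal S, I.IsMaximal → J ≤ I → ¬ 𝔪.map (algebraMap T S) ≤ I) :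
    ∃ s ∉ 𝔪, algebraMap T S s ∈ J := by
  by_contra! hcon
  -- Otherwise the kernel of `T → S ⧸ J` lies in `𝔪`, and lying over gives a prime that contradicts
  -- `h`.
  obtain ⟨Q, -, hQ, hQ'⟩ := Ideal.exists_ideal_over_prime_of_isIntegral (S := S ⧸ J) 𝔪 ⊥ (by
    intro t ht
    by_contra hm
    refine hcon t hm ?_
    rw [Ideal.mem_comap, Ideal.mem_bot, IsScalarTower.algebraMap_apply T S (S ⧸ J)] at ht
    exact Ideal.Quotient.eq_zero_iff_mem.1 ht)
  have hP : (Q.comap (Ideal.Quotient.mk J)).IsPrime := Ideal.comap_isPrime _ _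
  obtain ⟨I, hI, hle⟩ := Ideal.exists_le_maximal _ hP.ne_top
  refine h I hI (le_trans (fun x hx => ?_) hle) ((Ideal.map_le_iff_le_comap.2 fun t ht => ?_).trans hle)
  · rw [Ideal.mem_comap, Ideal.Quotient.eq_zero_iff_mem.2 hx]
    exact Q.zero_mem
  · rw [← hQ', Ideal.mem_comap, IsScalarTower.algebraMap_apply T S (S ⧸ J)] at ht
    exact ht

end Integral

/-! ### Comaximality after localization. -/

section Localized

variable {T S : Type*} [CommRing T] [CommRing S] [Algebra T S] {n : ℕ}

/-- A set of elements of `S` that behave like monic polynomials over `T`. -/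
structure IsMonicSet (T : Type*) {S : Type*} [CommRing T] [CommRing S] [Algebra T S]
    (𝒢 : Set S) : Prop where
  mul : ∀ f ∈ 𝒢, ∀ g ∈ 𝒢, f * g ∈ 𝒢
  add : ∀ f ∈ 𝒢, ∀ x, ∃ y, x + f * y ∈ 𝒢
  isIntegral : ∀ f ∈ 𝒢, Algebra.IsIntegral T (S ⧸ Ideal.span {f})

theorem exists_rel_comaximal_localized (hft : Algebra.FiniteType T S) {𝒢 : Set S}
    (h𝒢 : IsMonicSet T 𝒢) (𝔪 : Ideal T) [𝔪.IsMaximal] (A : Type*) [CommRing A] [Algebra S A]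
    (hA : ∀ s ∉ 𝔪, IsUnit (algebraMap S A (algebraMap T S s)))
    {r : (Fin (2 * n) → S) → (Fin (2 * n) → S) → Prop} (hr : IsMoveRel r)
    {a z : Fin (2 * n)} (haz : z ≠ a) (hsaz : z ≠ sig a) (hroom : HasRoom r a z)
    (u : Fin (2 * n) → S) (hu : IsUnimodular u) (hz : u z ∈ 𝒢) :
    ∃ v, r u v ∧ ∃ x y : A, algebraMap S A (v a) * x + algebraMap S A (v z) * y = 1 := by
  have hfin : ∀ f ∈ 𝒢, {I : Ideal S | I.IsMaximal ∧ f ∈ I ∧ 𝔪.map (algebraMap T S) ≤ I}.Finite := by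
    intro f hf
    have := finite_setOf_isMaximal hft 𝔪 _ (h𝒢.isIntegral f hf)
    simpa only [Ideal.span_singleton_le_iff_mem] using this
  obtain ⟨v, huv, hv, hmax⟩ := exists_rel_comaximal hr haz hsaz hroom _ 𝒢 h𝒢.mul h𝒢.add hfin u
    (fun I hI => by
      by_contra! h
      obtain ⟨s, hs⟩ := hu
      exact hI.ne_top ((Ideal.eq_top_iff_one I).2
        (hs ▸ I.sum_mem fun i _ => I.mul_mem_right _ (h i)))) hz
  have hle : Ideal.span {v z} ≤ Ideal.span {v a, v z} := Ideal.span_mono (by simp)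
  have hint : Algebra.IsIntegral T (S ⧸ Ideal.span {v a, v z}) := by
    have := h𝒢.isIntegral _ hv
    exact Algebra.IsIntegral.of_surjective (Ideal.Quotient.factorₐ T hle)
      (Ideal.Quotient.factor_surjective hle)
  obtain ⟨s, hs, hs'⟩ := exists_algebraMap_mem 𝔪 _ hint (fun I hI hI' hm =>
    hmax I hI (hI' (Ideal.subset_span (by simp))) hm (hI' (Ideal.subset_span (by simp))))
  obtain ⟨x, y, hxy⟩ := Ideal.mem_span_pair.1 hs'
  obtain ⟨w, hw⟩ := (hA s hs).exists_right_inv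
  refine ⟨v, huv, algebraMap S A x * w, algebraMap S A y * w, ?_⟩
  rw [← hxy, map_add, map_mul, map_mul] at hw
  linear_combination hw

end Localized

/-! ### From real to rational cone coefficients. -/

section Rational

/-- On the finite-dimensional `ℚ`-span of `s`, positivity on `s` is an open condition on the images
of a basis. The inclusion into `ℝ` satisfies it, so a nearby rational choice does too. -/
theorem exists_ratLinear_pos (s : Finset ℝ) (hs : ∀ c ∈ s, 0 < c) :
    ∃ l : ℝ →ₗ[ℚ] ℚ, ∀ c ∈ s, 0 < l c := by
  let L : Submodule ℚ ℝ := Submodule.span ℚ (s : Set ℝ)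
  have : FiniteDimensional ℚ L := FiniteDimensional.span_finset ℚ s
  let b := Module.finBasis ℚ L
  have hsL : ∀ c ∈ s, c ∈ L := fun c hc => Submodule.subset_span hc
  let F : s → (Fin (Module.finrank ℚ L) → ℝ) → ℝ :=
    fun c t => ∑ i, (b.repr ⟨c, hsL c c.2⟩ i : ℝ) * t i
  have hopen : IsOpen {t | ∀ c, 0 < F c t} := by
    simp only [Set.ofPred_forall]
    exact isOpen_iInter_of_finite fun c =>
      isOpen_lt continuous_const (by fun_prop)
  have hmem : (fun i => ((b i : L) : ℝ)) ∈ {t | ∀ c, 0 < F c t} := by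
    intro c
    have h := congrArg (Subtype.val : L → ℝ) (b.sum_repr ⟨c, hsL c c.2⟩)
    simp only [AddSubmonoidClass.coe_finsetSum, Submodule.coe_smul, Rat.smul_def] at h
    change 0 < ∑ i, _
    rw [h]
    exact hs c c.2
  have hd : DenseRange (Pi.map fun (_ : Fin (Module.finrank ℚ L)) (q : ℚ) => (q : ℝ)) :=
    DenseRange.piMap fun _ => Rat.denseRange_cast
  obtain ⟨q, hq⟩ := hd.exists_mem_open hopen ⟨_, hmem⟩
  obtain ⟨l, hl⟩ := (b.constr ℚ q).exists_extend
  refine ⟨l, fun c hc => ?_⟩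
  have h1 : l c = b.constr ℚ q ⟨c, hsL c hc⟩ := by
    rw [← hl]
    rfl
  have h2 := hq ⟨c, hc⟩
  rw [h1, Module.Basis.constr_apply_fintype]
  have h3 : (0 : ℝ) < ((∑ i, b.equivFun ⟨c, hsL c hc⟩ i • q i : ℚ) : ℝ) := by
    push_cast
    simpa [F, Pi.map] using h2
  exact_mod_cast h3

theorem exists_nat_multiples {ι : Type*} [Fintype ι] (q : ι → ℚ) (hq : ∀ i, 0 ≤ q i) :
    ∃ D : ℕ, 0 < D ∧ ∃ k : ι → ℕ, ∀ i, (D : ℚ) * q i = k i := by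
  classical
  refine ⟨∏ i, (q i).den, Finset.prod_pos fun i _ => (q i).den_pos,
    fun i => (∏ j ∈ Finset.univ.erase i, (q j).den) * (q i).num.toNat, fun i => ?_⟩
  rw [← Finset.mul_prod_erase _ _ (Finset.mem_univ i)]
  have h1 : ((q i).num.toNat : ℚ) = ((q i).num : ℚ) := by
    exact_mod_cast Int.toNat_of_nonneg (Rat.num_nonneg.2 (hq i))
  have h2 : ((q i).den : ℚ) * q i = (q i).num := Rat.den_mul_eq_num _
  push_cast
  rw [h1, ← h2]
  ring

variable {d : ℕ}

/-- An integral point in the real cone of `M` has a positive multiple in `M`. -/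
theorem exists_nsmul_mem_of_mem_cone (M : AddSubmonoid (Fin d → ℤ)) (y : Fin d → ℤ)
    (hy : toReal y ∈ cone M) : ∃ N : ℕ, 0 < N ∧ N • y ∈ M := by
  classical
  obtain ⟨k, f, g, hfg⟩ := Submodule.mem_span_set'.1 hy
  choose x hx hxg using fun i => (g i).2
  -- Applying `l` to each coordinate of the real relation for `1 * y` gives a rational one with
  -- nonnegative coefficients, and `l 1 > 0` makes the multiple of `y` positive.
  obtain ⟨l, hl⟩ := exists_ratLinear_pos
    (insert 1 ((Finset.univ.image fun i => (f i : ℝ)).filter (0 < ·))) (by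
      intro c hc
      rcases Finset.mem_insert.1 hc with rfl | hc
      · exact one_pos
      · exact (Finset.mem_filter.1 hc).2)
  have hl1 : 0 < l 1 := hl 1 (Finset.mem_insert_self _ _)
  have hlf : ∀ i, 0 ≤ l (f i) := by
    intro i
    rcases eq_or_lt_of_le (f i).2 with h | h
    · have : ((f i : NNReal) : ℝ) = 0 := h.symm
      rw [this, map_zero]
    · exact (hl _ (Finset.mem_insert_of_mem (Finset.mem_filter.2
        ⟨Finset.mem_image_of_mem _ (Finset.mem_univ i), h⟩))).le
  obtain ⟨D, hD, m, hm⟩ := exists_nat_multiples (fun o : Option (Fin k) => o.elim (l 1)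
    fun i => l (f i)) (by rintro (_ | i); exacts [hl1.le, hlf i])
  have hint : ∀ (c : ℝ) (z : ℤ), l (c * z) = l c * z := by
    intro c z
    rw [mul_comm, ← zsmul_eq_mul, map_zsmul, zsmul_eq_mul, mul_comm]
  refine ⟨m none, ?_, ?_⟩
  · have h := hm none
    have : (0 : ℚ) < m none := by
      rw [← h]
      have : (0 : ℚ) < D := by exact_mod_cast hD
      exact mul_pos this hl1
    exact_mod_cast this
  · have h : m none • y = ∑ i, m (some i) • x i := by
      funext t
      have h1 : ∑ i, ((f i : ℝ)) * (x i t : ℝ) = 1 * (y t : ℝ) := by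
        have := congrFun hfg t
        simp only [Finset.sum_apply, Pi.smul_apply, ← hxg] at this
        simpa [toReal, NNReal.smul_def] using this
      have h2 := congrArg l h1
      rw [map_sum, hint] at h2
      simp only [hint] at h2
      have h3 : (m none : ℚ) * (y t : ℚ) = ∑ i, (m (some i) : ℚ) * (x i t : ℚ) := by
        rw [← hm none]
        simp only [← hm (some _), Option.elim, mul_assoc, ← h2, Finset.mul_sum]
      simp only [Pi.smul_apply, Finset.sum_apply, nsmul_eq_mul]
      exact_mod_cast h3
    rw [h]
    exact M.sum_mem fun i _ => M.nsmul_mem (hx i) _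

end Rational

/-! ### Integrality by a weight argument. -/

section Weighted

variable {T Q : Type*} [CommRing T] [CommRing Q] [Algebra T Q]

/-- If `m^c` is a `T`-linear combination of `1` and elements `xᵢ` such that `xᵢ^k` is a multiple of
a power of `m` with exponent less than `kc`, then `m` is integral. -/
theorem isIntegral_of_pow_eq_add_sum {ι : Type*} [Fintype ι] (m : Q) (x : ι → Q) (y t : ι → T)
    (t₀ : T) (k c : ℕ) (j : ι → ℕ) (hk : 0 < k) (hc : 0 < c) (hj : ∀ i, j i < k * c)
    (hx : ∀ i, x i ^ k = algebraMap T Q (y i) * m ^ j i)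
    (hm : m ^ c = algebraMap T Q t₀ + ∑ i, algebraMap T Q (t i) * x i) : IsIntegral T m := by
  classical
  let mon : ℕ → (ι → ℕ) → Q := fun a e => m ^ a * ∏ i, x i ^ e i
  let W : Submodule T Q := Submodule.span T
    (Set.range fun p : Fin c × (ι → Fin k) => mon p.1 fun i => p.2 i)
  have mon_mul : ∀ a e b f, mon a e * mon b f = mon (a + b) (e + f) := by
    intro a e b f
    simp only [mon, Pi.add_apply, pow_add, Finset.prod_mul_distrib]
    ring
  have mon_single : ∀ i l, mon 0 (Pi.single i l) = x i ^ l := by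
    intro i l
    simp only [mon, pow_zero, one_mul]
    rw [Finset.prod_eq_single i]
    · simp
    · intro b _ hb
      simp [hb]
    · simp
  have mon_zero : ∀ a, mon a 0 = m ^ a := fun a => by simp [mon]
  have sum_single : ∀ i l, ∑ b, j b * (Pi.single i l : ι → ℕ) b = j i * l := by
    intro i l
    rw [Finset.sum_eq_single i]
    · simp
    · intro b _ hb
      simp [hb]
    · simp
  have sum_single' : ∀ i l, ∑ b, (Pi.single i l : ι → ℕ) b = l := by
    intro i l
    rw [Finset.sum_eq_single i]
    · simp
    · intro b _ hb
      simp [hb]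
    · simp
  -- Give `m` weight `k` and `x i` weight `j i`. Replacing `x i ^ k` keeps the weight and lowers the
  -- exponent sum; replacing `m ^ c` lowers the weight because `j i < k * c`. So lexicographic
  -- induction terminates.
  have hW : ∀ w s a e, k * a + ∑ i, j i * e i = w → ∑ i, e i = s → mon a e ∈ W := by
    intro w
    induction w using Nat.strong_induction_on with
    | _ w ihw =>
    intro s
    induction s using Nat.strong_induction_on with
    | _ s ihs =>
    intro a e hw hs
    by_cases he : ∃ i, k ≤ e i
    · obtain ⟨i, hi⟩ := he
      obtain ⟨f, rfl⟩ : ∃ f : ι → ℕ, e = f + (Pi.single i k : ι → ℕ) := by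
        refine ⟨e - Pi.single i k, ?_⟩
        funext b
        rw [Pi.add_apply, Pi.sub_apply]
        by_cases hb : b = i
        · subst hb
          simp [hi]
        · simp [hb]
      have h1 : mon a (f + Pi.single i k) = y i • mon (a + j i) f := by
        have := mon_mul a f 0 (Pi.single i k)
        rw [add_zero] at this
        rw [← this, mon_single, hx, Algebra.smul_def, ← add_zero f, ← mon_mul, mon_zero, add_zero]
        ring
      rw [h1]
      refine W.smul_mem _ (ihs (∑ b, f b) ?_ _ _ ?_ rfl)
      · rw [← hs]
        simp only [Pi.add_apply, Finset.sum_add_distrib, sum_single']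
        omega
      · rw [← hw]
        simp only [Pi.add_apply, mul_add, Finset.sum_add_distrib, sum_single]
        ring
    push Not at he
    by_cases ha : c ≤ a
    · obtain ⟨b, rfl⟩ := Nat.exists_eq_add_of_le' ha
      have h1 : mon (b + c) e = t₀ • mon b e + ∑ i, t i • mon b (e + Pi.single i 1) := by
        have h2 : ∀ i, mon b (e + Pi.single i 1) = mon b e * x i := by
          intro i
          rw [← pow_one (x i), ← mon_single, mon_mul, add_zero]
        rw [← add_zero e, ← mon_mul, mon_zero, hm, add_zero]
        simp only [h2, Algebra.smul_def, mul_add, Finset.mul_sum]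
        congr 1
        · ring
        · exact Finset.sum_congr rfl fun i _ => by ring
      rw [h1]
      have hkc : 0 < k * c := Nat.mul_pos hk hc
      refine W.add_mem (W.smul_mem _ (ihw (k * b + ∑ i, j i * e i) ?_ _ _ _ rfl rfl))
        (W.sum_mem fun i _ => W.smul_mem _ (ihw _ ?_ _ _ _ rfl rfl))
      · rw [← hw, mul_add]
        omega
      · rw [← hw]
        simp only [Pi.add_apply, mul_add, Finset.sum_add_distrib, sum_single]
        have := hj i
        omega
    · push Not at ha
      exact Submodule.subset_span ⟨(⟨a, ha⟩, fun i => ⟨e i, he i⟩), rfl⟩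
  -- The span of all monomials is a subalgebra containing `m`; being equal to `W`, it is a finite
  -- module, so `m` is integral.
  let P : Submonoid Q :=
    { carrier := {q | ∃ a e, mon a e = q}
      one_mem' := ⟨0, 0, by simp [mon_zero]⟩
      mul_mem' := by
        rintro _ _ ⟨a, e, rfl⟩ ⟨b, f, rfl⟩
        exact ⟨_, _, (mon_mul a e b f).symm⟩ }
  have hP : Submodule.span T (P : Set Q) = W := by
    refine le_antisymm (Submodule.span_le.2 ?_) (Submodule.span_mono ?_)
    · rintro _ ⟨a, e, rfl⟩
      exact hW _ _ a e rfl rfl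
    · rintro _ ⟨p, rfl⟩
      exact ⟨_, _, rfl⟩
  refine IsIntegral.of_mem_of_fg (Algebra.adjoin T (P : Set Q)) ?_ m
    (Algebra.subset_adjoin ⟨1, 0, by simp [mon_zero]⟩)
  rw [Algebra.adjoin_eq_span, Submonoid.closure_eq, hP]
  exact Submodule.fg_span (Set.finite_range _)

end Weighted

/-! ### Geometry of the pyramidal decomposition. -/

section Geometry

variable {d : ℕ} {M : AddSubmonoid (Fin d → ℤ)} {H : CuttingHyperplane M} {m : M}
  {Δ Γ : Set (Fin d → ℝ)} {δ : (Fin d → ℝ) →ₗ[ℝ] ℝ}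

theorem toReal_zero : toReal (0 : Fin d → ℤ) = 0 := by
  funext i
  simp [toReal]

theorem toReal_neg (x : Fin d → ℤ) : toReal (-x) = -toReal x := by
  funext i
  simp [toReal]

theorem toReal_nsmul (k : ℕ) (x : Fin d → ℤ) : toReal (k • x) = (k : ℝ) • toReal x := by
  funext i
  simp [toReal]

theorem smul_mem_cone {c : Fin d → ℝ} (hc : c ∈ cone M) {t : ℝ} (ht : 0 ≤ t) : t • c ∈ cone M :=
  Submodule.smul_mem (Submodule.span NNReal (toReal '' (M : Set (Fin d → ℤ)))) (⟨t, ht⟩ : NNReal) hc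

theorem convex_cone (M : AddSubmonoid (Fin d → ℤ)) : Convex ℝ (cone M) :=
  fun _ hx _ hy _ _ ha hb _ => Submodule.add_mem
    (Submodule.span NNReal (toReal '' (M : Set (Fin d → ℤ)))) (smul_mem_cone hx ha)
    (smul_mem_cone hy hb)

theorem CuttingHyperplane.convex_polytope (H : CuttingHyperplane M) : Convex ℝ H.polytope :=
  (convex_hyperplane H.α.toLinearMap.isLinear H.a).inter (convex_cone M)

theorem CuttingHyperplane.phi_mem_polytope (H : CuttingHyperplane M) {x : Fin d → ℤ} (hx : x ∈ M)
    (h0 : x ≠ 0) : H.phi x ∈ H.polytope := by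
  have hpos := H.pos hx h0
  refine ⟨?_, smul_mem_cone (toReal_mem_cone hx) (div_nonneg H.a_pos.le hpos.le)⟩
  change H.α _ = H.a
  rw [CuttingHyperplane.phi, map_smul, smul_eq_mul]
  field_simp

theorem CuttingHyperplane.toReal_eq_smul_phi (H : CuttingHyperplane M) {x : Fin d → ℤ}
    (hx : x ∈ M) (h0 : x ≠ 0) : toReal x = (H.α (toReal x) / H.a) • H.phi x := by
  have hpos := (H.pos hx h0).ne'
  have ha := H.a_pos.ne'
  rw [CuttingHyperplane.phi, smul_smul]
  field_simp
  simp

theorem IsPolytope.isClosed {Q : Set (Fin d → ℝ)} (h : IsPolytope Q) : IsClosed Q := by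
  obtain ⟨s, rfl⟩ := h
  exact (s.finite_toSet.isCompact_convexHull ℝ).isClosed

theorem IsExtremalGenerator.ne_zero (h : IsExtremalGenerator H m) : (m : Fin d → ℤ) ≠ 0 := by
  intro h0
  have h1 : H.α (H.phi m) = H.a := h.vertex.1.1
  rw [h0, CuttingHyperplane.phi, toReal_zero, smul_zero, map_zero] at h1
  exact H.a_pos.ne h1

theorem IsPyramidalDecomposition.subset_of_phi_mem (hdec : IsPyramidalDecomposition H m Δ Γ)
    (h : H.phi m ∈ Γ) : Δ ⊆ Γ := by
  rw [hdec.pyramid]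
  exact convexHull_min (Set.insert_subset h Set.inter_subset_right) hdec.polytope_Γ.convex

theorem IsPyramidalDecomposition.phi_mem (hdec : IsPyramidalDecomposition H m Δ Γ) {x : Fin d → ℤ}
    (hx : x ∈ M) (h0 : x ≠ 0) : H.phi x ∈ Δ ∨ H.phi x ∈ Γ := by
  have := H.phi_mem_polytope hx h0
  rwa [hdec.union] at this

theorem IsPyramidalDecomposition.phi_generator_mem (hdec : IsPyramidalDecomposition H m Δ Γ) :
    H.phi m ∈ Δ := by
  have : H.phi m ∈ convexHull ℝ (insert (H.phi m) (Δ ∩ Γ)) :=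
    subset_convexHull ℝ _ (Set.mem_insert _ _)
  rwa [← hdec.pyramid] at this

/-- A point of the pyramid `Δ` lies on a segment from the apex `φ(m)` to the base `Δ ∩ Γ`. The
alternative `w = 0` covers an empty base. -/
theorem exists_eq_toReal_add_smul (hdec : IsPyramidalDecomposition H m Δ Γ) {x : Fin d → ℤ}
    (hx : x ∈ M) (h0 : x ≠ 0) (hxΔ : H.phi x ∈ Δ) :
    ∃ s w : ℝ, ∃ z, 0 ≤ s ∧ 0 ≤ w ∧ toReal x = s • toReal m + w • z ∧ (w = 0 ∨ z ∈ Δ ∩ Γ) := by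
  have hx' := H.toReal_eq_smul_phi hx h0
  have hc : 0 < H.α (toReal x) / H.a := div_pos (H.pos hx h0) H.a_pos
  have hb : 0 < H.a / H.α (toReal m) := div_pos H.a_pos (H.pos m.2 hdec.extremal.ne_zero)
  have hm : H.phi m = (H.a / H.α (toReal m)) • toReal m := rfl
  rw [hdec.pyramid] at hxΔ
  generalize H.a / H.α (toReal m) = b at hb hm
  generalize H.α (toReal x) / H.a = c at hc hx'
  rcases (Δ ∩ Γ).eq_empty_or_nonempty with he | hne
  · rw [he, insert_empty_eq, convexHull_singleton, Set.mem_singleton_iff] at hxΔ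
    refine ⟨c * b, 0, 0, by positivity, le_rfl, ?_, Or.inl rfl⟩
    rw [hx', hxΔ, hm, smul_smul, smul_zero, add_zero]
  · rw [convexHull_insert hne, (hdec.polytope_Δ.convex.inter hdec.polytope_Γ.convex).convexHull_eq,
      mem_convexJoin] at hxΔ
    obtain ⟨p, hp, z, hz, hseg⟩ := hxΔ
    rw [Set.mem_singleton_iff] at hp
    obtain ⟨t, w, ht, hw, -, htw⟩ := hseg
    refine ⟨c * t * b, c * w, z, by positivity, by positivity, ?_, Or.inr hz⟩
    rw [hx', ← htw, hp, hm]
    simp only [smul_add, smul_smul, mul_assoc]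

theorem exists_int_eq (hδ : IsPyramidalFunctional M Δ Γ δ) {x : Fin d → ℤ} (hx : x ∈ gp M) :
    ∃ k : ℤ, δ (toReal x) = k := by
  have : δ (toReal x) ∈ Set.range ((↑) : ℤ → ℝ) := by
    rw [← hδ.onto]
    exact ⟨x, hx, rfl⟩
  obtain ⟨k, hk⟩ := this
  exact ⟨k, hk.symm⟩

/-- If `δ` vanished at the apex, it would vanish on `Δ`. As `Γ` is closed, `Δ` contains a
neighbourhood of the apex in `φ(M)`, so `δ` would vanish on `φ(M)` and on `gp(M)`, against
surjectivity onto `ℤ`. -/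
theorem delta_pos (hdec : IsPyramidalDecomposition H m Δ Γ) (hδ : IsPyramidalFunctional M Δ Γ δ)
    (hm : H.phi m ∉ Γ) : 0 < δ (toReal m) := by
  have hmΔ := hdec.phi_generator_mem
  have hpos := div_pos (H.pos m.2 hdec.extremal.ne_zero) H.a_pos
  rw [H.toReal_eq_smul_phi m.2 hdec.extremal.ne_zero, map_smul, smul_eq_mul]
  refine mul_pos hpos (lt_of_le_of_ne (hδ.nonneg _ hmΔ) fun h0 => ?_)
  have hΔ : ∀ x ∈ Δ, δ x = 0 := by
    intro x hx
    rw [hdec.pyramid] at hx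
    refine convexHull_min (t := {x | δ x = 0}) ?_ (convex_hyperplane δ.isLinear 0) hx
    exact Set.insert_subset h0.symm fun y hy => hδ.vanish y hy
  have hpoly : ∀ p ∈ H.polytope, δ p = 0 := by
    intro p hp
    have hcont : Continuous fun t : ℝ => H.phi m + t • (p - H.phi m) := by fun_prop
    have hev : ∀ᶠ t in nhds (0 : ℝ), H.phi m + t • (p - H.phi m) ∈ Γᶜ :=
      hcont.continuousAt.eventually
        (hdec.polytope_Γ.isClosed.isOpen_compl.mem_nhds (by simpa using hm))
    obtain ⟨ε, hε, hball⟩ := Metric.eventually_nhds_iff.1 hev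
    have ht0 : 0 < min (ε / 2) 1 := by positivity
    have htΓ : H.phi m + min (ε / 2) 1 • (p - H.phi m) ∈ Γᶜ := by
      refine hball ?_
      rw [Real.dist_eq, sub_zero, abs_of_pos ht0]
      exact lt_of_le_of_lt (min_le_left _ _) (by linarith)
    have hmem : H.phi m + min (ε / 2) 1 • (p - H.phi m) ∈ H.polytope :=
      H.convex_polytope.add_smul_sub_mem (by rw [hdec.union]; exact Or.inl hmΔ) hp
        ⟨ht0.le, min_le_right _ _⟩
    rw [hdec.union] at hmem
    have h1 := hΔ _ (hmem.resolve_right htΓ)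
    rw [map_add, map_smul, map_sub, ← h0, sub_zero, zero_add, smul_eq_mul] at h1
    exact (mul_eq_zero.1 h1).resolve_left ht0.ne'
  have hgp : ∀ x ∈ gp M, δ (toReal x) = 0 := by
    intro x hx
    induction hx using AddSubgroup.closure_induction with
    | mem x hx =>
      by_cases hx0 : x = 0
      · rw [hx0, toReal_zero, map_zero]
      · rw [H.toReal_eq_smul_phi hx hx0, map_smul, hpoly _ (H.phi_mem_polytope hx hx0), smul_zero]
    | zero => rw [toReal_zero, map_zero]
    | add x y _ _ hx hy => rw [toReal_add, map_add, hx, hy, add_zero]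
    | neg x _ hx => rw [toReal_neg, map_neg, hx, neg_zero]
  have h1 : (1 : ℝ) ∈ Set.range ((↑) : ℤ → ℝ) := ⟨1, by simp⟩
  rw [← hδ.onto] at h1
  obtain ⟨x, hx, hx1⟩ := h1
  have := hgp x hx
  simp only at hx1
  linarith

/-- A multiple of an element of `M(Δ)` is the sum of an element of `M(Γ)` of degree `0` and a
multiple of the extremal generator. -/
theorem exists_nsmul_eq_add (hM : IsAffinePositiveNormal M) (hdec : IsPyramidalDecomposition H m Δ Γ)
    (hδ : IsPyramidalFunctional M Δ Γ δ) (hm : H.phi m ∉ Γ) :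
    ∃ q : ℕ, 0 < q ∧ δ (toReal m) = q ∧ ∀ x : M, x ∉ H.submonoid Γ hdec.polytope_Γ.convex →
      ∃ p : ℕ, δ (toReal x) = p ∧
        ∃ y ∈ H.submonoid Γ hdec.polytope_Γ.convex, q • x = y + p • m := by
  have hMgp : ∀ x ∈ M, x ∈ gp M := fun x hx => AddSubgroup.subset_closure hx
  have hpos := delta_pos hdec hδ hm
  obtain ⟨q', hq'⟩ := exists_int_eq hδ (hMgp m m.2)
  have hq0 : 0 < q' := by
    rw [hq'] at hpos
    exact_mod_cast hpos
  obtain ⟨q, rfl⟩ := Int.eq_ofNat_of_zero_le hq0.le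
  rw [Int.cast_natCast] at hq'
  refine ⟨q, by exact_mod_cast hq0, hq', fun x hx => ?_⟩
  change ¬ ((x = 0) ∨ H.phi x ∈ Γ) at hx
  push Not at hx
  have hx0 : (x : Fin d → ℤ) ≠ 0 := fun h => hx.1 (Subtype.ext h)
  have hxΔ := (hdec.phi_mem x.2 hx0).resolve_right hx.2
  obtain ⟨s, w, z, hs, hw, hxsw, hz⟩ := exists_eq_toReal_add_smul hdec x.2 hx0 hxΔ
  have hδx : δ (toReal x) = s * q := by
    rw [hxsw, map_add, map_smul, map_smul, hq']
    rcases hz with h | h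
    · simp [h]
    · simp [hδ.vanish z h]
  obtain ⟨p', hp'⟩ := exists_int_eq hδ (hMgp x x.2)
  have hp0 : 0 ≤ p' := by
    have : (0 : ℝ) ≤ p' := by
      rw [← hp', hδx]
      positivity
    exact_mod_cast this
  obtain ⟨p, rfl⟩ := Int.eq_ofNat_of_zero_le hp0
  rw [Int.cast_natCast] at hp'
  -- Since `p = s * q`, the `m`-components cancel, leaving a nonnegative multiple of the base point
  -- `z`. Hence `y₀` is in the cone, and normality puts it into `M`.
  let y₀ : Fin d → ℤ := q • (x : Fin d → ℤ) - p • (m : Fin d → ℤ)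
  have hy₀ : toReal y₀ = ((q : ℝ) * w) • z := by
    have h1 : toReal y₀ = (q : ℝ) • toReal x - (p : ℝ) • toReal m := by
      simp only [y₀, sub_eq_add_neg, toReal_add, toReal_neg, toReal_nsmul]
    rw [h1, ← hp', hδx, hxsw]
    simp only [smul_add, smul_smul]
    rw [mul_comm s, add_sub_cancel_left]
  have hq : (0 : ℝ) < q := by exact_mod_cast hq0
  have hcone : toReal y₀ ∈ cone M := by
    rw [hy₀]
    rcases hz with h | h
    · rw [h, mul_zero, zero_smul]
      exact Submodule.zero_mem (Submodule.span NNReal (toReal '' (M : Set (Fin d → ℤ))))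
    · refine smul_mem_cone ?_ (by positivity)
      have : z ∈ H.polytope := by
        rw [hdec.union]
        exact Or.inl h.1
      exact this.2
  have hgp : y₀ ∈ gp M :=
    (gp M).sub_mem ((gp M).nsmul_mem (hMgp x x.2) _) ((gp M).nsmul_mem (hMgp m m.2) _)
  obtain ⟨N, hN, hNy⟩ := exists_nsmul_mem_of_mem_cone M y₀ hcone
  have hy₀M := hM.normal y₀ hgp N hN hNy
  refine ⟨p, hp', ⟨y₀, hy₀M⟩, ?_, ?_⟩
  · by_cases h0 : y₀ = 0
    · exact Or.inl (Subtype.ext h0)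
    · right
      have hα := H.pos hy₀M h0
      rw [hy₀, map_smul, smul_eq_mul] at hα
      have hw0 : w ≠ 0 := by
        rintro rfl
        simp at hα
      have hzΓ := hz.resolve_left hw0
      have hzα : H.α z = H.a := by
        have : z ∈ H.polytope := by
          rw [hdec.union]
          exact Or.inl hzΓ.1
        exact this.1
      have : H.phi y₀ = z := by
        rw [CuttingHyperplane.phi, hy₀, map_smul, smul_eq_mul, hzα, smul_smul]
        have ha := H.a_pos.ne'
        have : H.a / (q * w * H.a) * (q * w) = 1 := by
          field_simp
        rw [this, one_smul]
      change H.phi y₀ ∈ Γ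
      rw [this]
      exact hzΓ.2
  · apply Subtype.ext
    simp [y₀]

end Geometry

/-! ### Monic elements and degree bounds. -/

section Monic

variable {d : ℕ} {M : AddSubmonoid (Fin d → ℤ)} {R : Type*} [CommRing R]

/-- All monomials of `h` have degree less than `D`. -/
def HasDegreeLT (δ : (Fin d → ℝ) →ₗ[ℝ] ℝ) (h : AddMonoidAlgebra R M) (D : ℝ) : Prop :=
  ∀ x ∈ h.coeff.support, δ (toReal x) < D

variable {δ : (Fin d → ℝ) →ₗ[ℝ] ℝ} {m : M}

theorem HasDegreeLT.add {h h' : AddMonoidAlgebra R M} {D : ℝ} (hh : HasDegreeLT δ h D)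
    (hh' : HasDegreeLT δ h' D) : HasDegreeLT δ (h + h') D := by
  classical
  intro x hx
  rw [AddMonoidAlgebra.coeff_add] at hx
  exact (Finset.mem_union.1 (Finsupp.support_add hx)).elim (hh x) (hh' x)

theorem HasDegreeLT.mul {h h' : AddMonoidAlgebra R M} {D D' : ℝ} (hh : HasDegreeLT δ h D)
    (hh' : HasDegreeLT δ h' D') : HasDegreeLT δ (h * h') (D + D') := by
  classical
  intro x hx
  obtain ⟨y, hy, z, hz, rfl⟩ := Finset.mem_add.1 (AddMonoidAlgebra.support_coeff_mul_subset _ _ hx)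
  rw [AddSubmonoid.coe_add, toReal_add, map_add]
  exact add_lt_add (hh y hy) (hh' z hz)

theorem HasDegreeLT.single_mul {h : AddMonoidAlgebra R M} {D : ℝ} (hh : HasDegreeLT δ h D) (x : M)
    (r : R) : HasDegreeLT δ (AddMonoidAlgebra.single x r * h) (δ (toReal x) + D) := by
  classical
  intro y hy
  obtain ⟨z, hz, rfl⟩ :=
    Finset.mem_image.1 (AddMonoidAlgebra.support_coeff_single_mul_subset _ _ _ hy)
  rw [AddSubmonoid.coe_add, toReal_add, map_add]
  linarith [hh z hz]

theorem HasDegreeLT.mono {h : AddMonoidAlgebra R M} {D D' : ℝ} (hh : HasDegreeLT δ h D)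
    (hD : D ≤ D') : HasDegreeLT δ h D' := fun x hx => (hh x hx).trans_le hD

theorem exists_hasDegreeLT (δ : (Fin d → ℝ) →ₗ[ℝ] ℝ) (h : AddMonoidAlgebra R M) :
    ∃ D, HasDegreeLT δ h D := by
  obtain ⟨D, hD⟩ := (h.coeff.support.image fun x : M => δ (toReal x)).exists_le
  exact ⟨D + 1, fun x hx => (hD _ (Finset.mem_image_of_mem _ hx)).trans_lt (by linarith)⟩

theorem delta_nsmul (k : ℕ) : δ (toReal ((k • m : M) : Fin d → ℤ)) = k * δ (toReal m) := by
  rw [AddSubmonoidClass.coe_nsmul, toReal_nsmul, map_smul, smul_eq_mul]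

/-- The elements of `R[M]` of the form `r m^c + h` with `r` a unit and `h` of smaller degree. -/
def monicSet (R : Type*) [CommRing R] (δ : (Fin d → ℝ) →ₗ[ℝ] ℝ) (m : M) :
    Set (AddMonoidAlgebra R M) :=
  {f | ∃ (r : Rˣ) (c : ℕ) (h : AddMonoidAlgebra R M),
    f = AddMonoidAlgebra.single (c • m) (r : R) + h ∧ HasDegreeLT δ h (c * δ (toReal m))}

theorem mul_mem_monicSet {f g : AddMonoidAlgebra R M} (hf : f ∈ monicSet R δ m)
    (hg : g ∈ monicSet R δ m) : f * g ∈ monicSet R δ m := by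
  obtain ⟨r, c, h, rfl, hh⟩ := hf
  obtain ⟨r', c', h', rfl, hh'⟩ := hg
  refine ⟨r * r', c + c', AddMonoidAlgebra.single (c • m) (r : R) * h' +
    (AddMonoidAlgebra.single (c' • m) (r' : R) * h + h * h'), ?_, ?_⟩
  · rw [add_smul, Units.val_mul, ← AddMonoidAlgebra.single_mul_single]
    ring
  · have h1 := hh'.single_mul (c • m) (r : R)
    have h2 := hh.single_mul (c' • m) (r' : R)
    rw [delta_nsmul] at h1 h2
    refine (h1.mono ?_).add ((h2.mono ?_).add ((hh.mul hh').mono ?_)) <;>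
    · push_cast
      linarith

/-- For `y = m^N` with `N` large, the leading term of `f * y` dominates `x`, because `δ(m) > 0`. -/
theorem exists_add_mul_mem_monicSet (hm : 0 < δ (toReal m)) {f : AddMonoidAlgebra R M}
    (hf : f ∈ monicSet R δ m) (x : AddMonoidAlgebra R M) : ∃ y, x + f * y ∈ monicSet R δ m := by
  obtain ⟨r, c, h, rfl, hh⟩ := hf
  obtain ⟨D, hD⟩ := exists_hasDegreeLT δ x
  obtain ⟨N, hN⟩ := exists_nat_ge (D / δ (toReal m))
  rw [div_le_iff₀ hm] at hN
  refine ⟨AddMonoidAlgebra.single (N • m) 1, r, N + c,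
    x + AddMonoidAlgebra.single (N • m) 1 * h, ?_, ?_⟩
  · rw [add_smul, ← one_mul (r : R), ← AddMonoidAlgebra.single_mul_single, one_mul]
    ring
  · have h1 := hh.single_mul (N • m) (1 : R)
    rw [delta_nsmul] at h1
    have hc : 0 ≤ (c : ℝ) * δ (toReal m) := by positivity
    refine (hD.mono ?_).add (h1.mono ?_) <;>
    · push_cast
      linarith

/-- As `r ≠ 0`, the monomial `m^c` really occurs in `f` with maximal degree; any other monomial of
that degree would show up in the leading term. -/
theorem IsMonicIn.mem_monicSet [Nontrivial R] {f : AddMonoidAlgebra R M} (hf : IsMonicIn δ m f) :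
    f ∈ monicSet R δ m := by
  classical
  obtain ⟨r, c, hrc⟩ := hf
  have hcoeff : ∀ x ∈ f.coeff.support, ((δ (toReal x) : ℝ) : WithBot ℝ) = pyramidalDegree δ f →
      (leadingTerm δ f).coeff x = f.coeff x := by
    intro x hx hdeg
    rw [leadingTerm, AddMonoidAlgebra.coeff_sum, Finsupp.finsetSum_apply, Finset.sum_eq_single x]
    · simp
    · intro y _ hy
      simp [hy]
    · intro h
      exact absurd (Finset.mem_filter.2 ⟨hx, hdeg⟩) h
  have hcoeff' : ∀ x, (x ∉ f.coeff.support ∨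
      ((δ (toReal x) : ℝ) : WithBot ℝ) ≠ pyramidalDegree δ f) →
      (leadingTerm δ f).coeff x = 0 := by
    intro x hx
    rw [leadingTerm, AddMonoidAlgebra.coeff_sum, Finsupp.finsetSum_apply]
    refine Finset.sum_eq_zero fun y hy => ?_
    have hyx : y ≠ x := by
      rintro rfl
      rw [Finset.mem_filter] at hy
      exact hx.elim (fun h => h hy.1) (fun h => h hy.2)
    simp [hyx]
  have hr : (leadingTerm δ f).coeff (c • m) = r := by
    rw [hrc]
    simp
  obtain ⟨hcs, hcd⟩ : c • m ∈ f.coeff.support ∧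
      ((δ (toReal (c • m : M)) : ℝ) : WithBot ℝ) = pyramidalDegree δ f := by
    by_contra hcon
    rw [not_and_or] at hcon
    exact r.ne_zero (hr.symm.trans (hcoeff' _ hcon))
  have hfc : f.coeff (c • m) = r := by rw [← hcoeff _ hcs hcd, hr]
  refine ⟨r, c, f - AddMonoidAlgebra.single (c • m) (r : R), by ring, fun x hx => ?_⟩
  have hxc : x ≠ c • m := by
    rintro rfl
    rw [Finsupp.mem_support_iff, AddMonoidAlgebra.coeff_sub] at hx
    simp [hfc] at hx
  have hxf : x ∈ f.coeff.support := by
    rw [Finsupp.mem_support_iff, AddMonoidAlgebra.coeff_sub] at hx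
    rw [Finsupp.mem_support_iff]
    simpa [hxc.symm] using hx
  have hle : ((δ (toReal x) : ℝ) : WithBot ℝ) ≤ pyramidalDegree δ f :=
    Finset.le_sup (f := fun x : M => ((δ (toReal x) : ℝ) : WithBot ℝ)) hxf
  have hne : ((δ (toReal x) : ℝ) : WithBot ℝ) ≠ pyramidalDegree δ f := by
    intro h
    have h1 := hcoeff x hxf h
    rw [hrc] at h1
    rw [Finsupp.mem_support_iff, ← h1] at hxf
    simp [hxc.symm] at hxf
  have := lt_of_le_of_ne hle hne
  rw [← hcd, WithBot.coe_lt_coe, delta_nsmul] at this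
  exact this

end Monic

/-! ### `R[M]` over `R[M(Γ)]`, and the conclusion. -/

section Inclusion

variable {d : ℕ} {M : AddSubmonoid (Fin d → ℤ)} {R : Type*} [CommRing R]

/-- `R[M]` as an algebra over `R[N]`, for a submonoid `N` of `M`. -/
noncomputable abbrev inclusionAlgebra (R : Type*) [CommRing R] (N : AddSubmonoid M) :
    Algebra (AddMonoidAlgebra R N) (AddMonoidAlgebra R M) :=
  (inclusion R N).toAlgebra

theorem inclusion_single (N : AddSubmonoid M) (x : N) (r : R) :
    inclusion R N (AddMonoidAlgebra.single x r) = AddMonoidAlgebra.single (x : M) r := by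
  simp [inclusion]

theorem finiteType_inclusion (hM : M.FG) (N : AddSubmonoid M) :
    letI := inclusionAlgebra R N
    Algebra.FiniteType (AddMonoidAlgebra R N) (AddMonoidAlgebra R M) := by
  let _ := inclusionAlgebra R N
  have : AddMonoid.FG M := (AddMonoid.fg_iff_addSubmonoid_fg M).2 hM
  have : IsScalarTower R (AddMonoidAlgebra R N) (AddMonoidAlgebra R M) :=
    IsScalarTower.of_algebraMap_eq fun r => by
      change _ = inclusion R N (AddMonoidAlgebra.single 0 r)
      rw [inclusion_single]
      rfl
  exact Algebra.FiniteType.of_restrictScalars_finiteType R _ _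

theorem isMonicSet_univ {N : AddSubmonoid M} (hN : ∀ x, x ∈ N) :
    letI := inclusionAlgebra R N
    IsMonicSet (AddMonoidAlgebra R N) (Set.univ : Set (AddMonoidAlgebra R M)) := by
  let _ := inclusionAlgebra R N
  have hsurj : ∀ f : AddMonoidAlgebra R M, ∃ g, inclusion R N g = f := by
    intro f
    induction f using AddMonoidAlgebra.induction_linear with
    | zero => exact ⟨0, map_zero _⟩
    | add f g hf hg =>
      obtain ⟨f, rfl⟩ := hf
      obtain ⟨g, rfl⟩ := hg
      exact ⟨f + g, map_add _ _ _⟩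
    | single x r => exact ⟨AddMonoidAlgebra.single ⟨x, hN x⟩ r, inclusion_single _ _ _⟩
  refine ⟨fun _ _ _ _ => trivial, fun _ _ _ => ⟨0, trivial⟩, fun f _ => ⟨fun s => ?_⟩⟩
  obtain ⟨s, rfl⟩ := Ideal.Quotient.mk_surjective s
  obtain ⟨t, rfl⟩ := hsurj s
  exact isIntegral_algebraMap (R := AddMonoidAlgebra R N) (x := t)

variable {δ : (Fin d → ℝ) →ₗ[ℝ] ℝ} {m : M}

/-- Modulo the monic element, `m^c = -r⁻¹h`. Terms of `h` in `N` are scalars; any other `x`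
satisfies `x^q = y m^p` with `p < qc` by the degree bound. So the weight argument applies to `m`,
and then `x^q`, hence `x`, is integral. -/
theorem isIntegral_quotient_span_monic {N : AddSubmonoid M} {q : ℕ} (hq : 0 < q)
    (hqm : δ (toReal m) = q)
    (hN : ∀ x : M, x ∉ N → ∃ p : ℕ, δ (toReal x) = p ∧ ∃ y ∈ N, q • x = y + p • m)
    (r : Rˣ) (c : ℕ) (hc : 0 < c) (h : AddMonoidAlgebra R M)
    (hh : HasDegreeLT δ h (c * δ (toReal m))) :
    letI := inclusionAlgebra R N
    Algebra.IsIntegral (AddMonoidAlgebra R N)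
      (AddMonoidAlgebra R M ⧸ Ideal.span {AddMonoidAlgebra.single (c • m) (r : R) + h}) := by
  classical
  let _ := inclusionAlgebra R N
  set J := Ideal.span {AddMonoidAlgebra.single (c • m) (r : R) + h} with hJ
  let π := Ideal.Quotient.mk J
  have halg : ∀ t, algebraMap (AddMonoidAlgebra R N) (AddMonoidAlgebra R M ⧸ J) t =
    π (inclusion R N t) := fun t => rfl
  let X : M → AddMonoidAlgebra R M ⧸ J := fun x => π (AddMonoidAlgebra.single x 1)
  have hX : ∀ x k, X x ^ k = X (k • x) := fun x k => by
    simp only [X, ← map_pow, AddMonoidAlgebra.single_pow, one_pow]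
  have hX' : ∀ x y, X (x + y) = X x * X y := fun x y => by
    simp only [X, ← map_mul, AddMonoidAlgebra.single_mul_single, one_mul]
  have hXr : ∀ x s, π (AddMonoidAlgebra.single x s) =
      algebraMap (AddMonoidAlgebra R N) _ (AddMonoidAlgebra.single 0 s) * X x := fun x s => by
    rw [halg, inclusion_single, ← map_mul, AddSubmonoid.coe_zero,
      AddMonoidAlgebra.single_mul_single, zero_add, mul_one]
  have hXN : ∀ x (hx : x ∈ N),
      X x = algebraMap (AddMonoidAlgebra R N) _ (AddMonoidAlgebra.single ⟨x, hx⟩ 1) :=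
    fun x hx => by rw [halg, inclusion_single]
  choose p hp y hy hxy using hN
  have hrel : ∀ x (hx : x ∉ N), X x ^ q = algebraMap (AddMonoidAlgebra R N) _
      (AddMonoidAlgebra.single ⟨y x hx, hy x hx⟩ 1) * X m ^ p x hx := fun x hx => by
    rw [hX, hxy x hx, hX', hX, hXN _ (hy x hx)]
  have hm : IsIntegral (AddMonoidAlgebra R N) (X m) := by
    refine isIntegral_of_pow_eq_add_sum (ι := {x // x ∈ h.coeff.support.filter (· ∉ N)}) (X m)
      (fun x => X x)
      (fun x => AddMonoidAlgebra.single ⟨y x (Finset.mem_filter.1 x.2).2, hy x _⟩ 1)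
      (fun x => AddMonoidAlgebra.single 0 (-(r⁻¹ : Rˣ) * h.coeff x))
      (∑ x : {x // x ∈ h.coeff.support.filter (· ∈ N)},
        AddMonoidAlgebra.single ⟨x, (Finset.mem_filter.1 x.2).2⟩ (-(r⁻¹ : Rˣ) * h.coeff x))
      q c (fun x => p x (Finset.mem_filter.1 x.2).2) hq hc (fun x => ?_) (fun x => hrel x _) ?_
    · have h1 := hh x (Finset.mem_filter.1 x.2).1
      rw [hp x (Finset.mem_filter.1 x.2).2, hqm] at h1
      rw [mul_comm]
      exact_mod_cast h1
    · have h1 : π (AddMonoidAlgebra.single (c • m) (r : R) + h) = 0 :=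
        Ideal.Quotient.eq_zero_iff_mem.2 (Ideal.mem_span_singleton_self _)
      have h2 : X m ^ c =
          π (AddMonoidAlgebra.single 0 (-(r⁻¹ : Rˣ) : R) * h) := by
        have h3 : π (AddMonoidAlgebra.single 0 ((r⁻¹ : Rˣ) : R) *
            (AddMonoidAlgebra.single (c • m) (r : R) + h)) = 0 := by
          rw [map_mul, h1, mul_zero]
        rw [mul_add, AddMonoidAlgebra.single_mul_single, zero_add, Units.inv_mul, map_add] at h3
        rw [hX, AddMonoidAlgebra.single_neg, neg_mul, map_neg]
        exact eq_neg_of_add_eq_zero_left h3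
      have h4 : AddMonoidAlgebra.single 0 (-(r⁻¹ : Rˣ) : R) * h =
          ∑ x ∈ h.coeff.support, AddMonoidAlgebra.single x (-(r⁻¹ : Rˣ) * h.coeff x) := by
        conv_lhs => rw [← AddMonoidAlgebra.sum_coeff_single h, Finsupp.sum, Finset.mul_sum]
        exact Finset.sum_congr rfl fun x _ => by
          rw [AddMonoidAlgebra.single_mul_single, zero_add]
      rw [h2, h4, ← Finset.sum_filter_add_sum_filter_not _ (· ∈ N), map_add, map_sum, map_sum,
        map_sum]
      congr 1
      · rw [← Finset.sum_coe_sort]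
        exact Finset.sum_congr rfl fun x _ => by rw [halg, inclusion_single]
      · rw [← Finset.sum_coe_sort]
        exact Finset.sum_congr rfl fun x _ => hXr _ _
  have hXint : ∀ x, IsIntegral (AddMonoidAlgebra R N) (X x) := by
    intro x
    by_cases hx : x ∈ N
    · rw [hXN x hx]
      exact isIntegral_algebraMap
    · refine IsIntegral.of_pow hq ?_
      rw [hrel x hx]
      exact isIntegral_algebraMap.mul (hm.pow _)
  refine ⟨fun s => ?_⟩
  obtain ⟨s, rfl⟩ := Ideal.Quotient.mk_surjective s
  induction s using AddMonoidAlgebra.induction_linear with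
  | zero => rw [map_zero]; exact isIntegral_zero
  | add f g hf hg => rw [map_add]; exact hf.add hg
  | single x s =>
    have := hXr x s
    simp only [π] at this
    rw [this]
    exact isIntegral_algebraMap.mul (hXint x)

theorem isMonicSet_monicSet {N : AddSubmonoid M} {q : ℕ} (hq : 0 < q)
    (hqm : δ (toReal m) = q)
    (hN : ∀ x : M, x ∉ N → ∃ p : ℕ, δ (toReal x) = p ∧ ∃ y ∈ N, q • x = y + p • m) :
    letI := inclusionAlgebra R N
    IsMonicSet (AddMonoidAlgebra R N) (monicSet R δ m) := by
  let _ := inclusionAlgebra R N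
  have hpos : 0 < δ (toReal m) := by
    rw [hqm]
    exact_mod_cast hq
  refine ⟨fun f hf g hg => mul_mem_monicSet hf hg,
    fun f hf x => exists_add_mul_mem_monicSet hpos hf x, ?_⟩
  rintro f ⟨r, c, h, rfl, hh⟩
  -- The exponent `c` may be `0`, so integrality is proved modulo `m * f`, with exponent `c + 1`,
  -- and passed to the quotient by `f`.
  have h1 : AddMonoidAlgebra.single m (1 : R) * (AddMonoidAlgebra.single (c • m) (r : R) + h) =
      AddMonoidAlgebra.single ((c + 1) • m) (r : R) + AddMonoidAlgebra.single m 1 * h := by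
    rw [mul_add, AddMonoidAlgebra.single_mul_single, one_mul, succ_nsmul']
  have h2 := isIntegral_quotient_span_monic (N := N) hq hqm hN r (c + 1) c.succ_pos
    (AddMonoidAlgebra.single m 1 * h) ((hh.single_mul m 1).mono (by push_cast; linarith))
  rw [← h1] at h2
  have hle : Ideal.span {AddMonoidAlgebra.single m (1 : R) *
      (AddMonoidAlgebra.single (c • m) (r : R) + h)} ≤
      Ideal.span {AddMonoidAlgebra.single (c • m) (r : R) + h} :=
    Ideal.span_singleton_le_span_singleton.2 (Dvd.intro_left _ rfl)
  exact Algebra.IsIntegral.of_surjective (Ideal.Quotient.factorₐ (AddMonoidAlgebra R N) hle)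
    (Ideal.Quotient.factor_surjective hle)

/-- For a pyramidal decomposition there is a set of monic elements of `R[M]` relative to `R[M(Γ)]`
that contains all elements monic in the extremal generator. -/
theorem exists_isMonicSet [Nontrivial R] {H : CuttingHyperplane M} {Δ Γ : Set (Fin d → ℝ)}
    (hM : IsAffinePositiveNormal M) (hdec : IsPyramidalDecomposition H m Δ Γ)
    (hδ : IsPyramidalFunctional M Δ Γ δ) :
    letI := inclusionAlgebra R (H.submonoid Γ hdec.polytope_Γ.convex)
    ∃ 𝒢 : Set (AddMonoidAlgebra R M),
      IsMonicSet (AddMonoidAlgebra R (H.submonoid Γ hdec.polytope_Γ.convex)) 𝒢 ∧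
        ∀ f, IsMonicIn δ m f → f ∈ 𝒢 := by
  -- In the degenerate case `M(Γ) = M`, and every element may count as monic.
  by_cases hm : H.phi m ∈ Γ
  · refine ⟨Set.univ, isMonicSet_univ fun x => ?_, fun _ _ => trivial⟩
    by_cases hx : x = 0
    · exact Or.inl hx
    · exact Or.inr ((hdec.phi_mem x.2 (fun h => hx (Subtype.ext h))).elim
        (fun h => hdec.subset_of_phi_mem hm h) id)
  · obtain ⟨q, hq, hqm, hN⟩ := exists_nsmul_eq_add hM hdec hδ hm
    exact ⟨monicSet R δ m, isMonicSet_monicSet hq hqm hN, fun f hf => hf.mem_monicSet⟩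

theorem two_mem_nonZeroDivisors (h : (2 : R) ∈ nonZeroDivisors R) :
    (2 : AddMonoidAlgebra R M) ∈ nonZeroDivisors (AddMonoidAlgebra R M) := by
  rw [mem_nonZeroDivisors_iff_right]
  intro f hf
  ext x
  have h1 : (f * 2).coeff x = 0 := by
    rw [hf]
    rfl
  rw [mul_two, AddMonoidAlgebra.coeff_add, Finsupp.add_apply, ← mul_two] at h1
  exact (mul_right_mem_nonZeroDivisors_eq_zero_iff h).1 h1

theorem orbitRel_e₁_localizeRow (hM : M.FG) {N : AddSubmonoid M} {𝒢 : Set (AddMonoidAlgebra R M)}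
    (h𝒢 : letI := inclusionAlgebra R N; IsMonicSet (AddMonoidAlgebra R N) 𝒢) {n : ℕ} (hn : 2 ≤ n)
    (u : Fin (2 * n) → AddMonoidAlgebra R M) (hu : IsUnimodular u)
    (z : Fin (2 * n)) (hz : (z : ℕ) = 2 * n - 1) (hlast : u z ∈ 𝒢) (𝔪 : Ideal (AddMonoidAlgebra R N)) [𝔪.IsMaximal] :
    OrbitRel (ESp (LocalizedAt N 𝔪) n) (localizeRow N 𝔪 u) e₁ ∧
      (3 ≤ n → (2 : R) ∈ nonZeroDivisors R → IsIsotropic u →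
        OrbitRel (EO (LocalizedAt N 𝔪) n) (localizeRow N 𝔪 u) e₁) := by
  let _ := inclusionAlgebra R N
  have hft := finiteType_inclusion (R := R) hM N
  have hA : ∀ s ∉ 𝔪, IsUnit (algebraMap (AddMonoidAlgebra R M) (LocalizedAt N 𝔪)
      (algebraMap (AddMonoidAlgebra R N) (AddMonoidAlgebra R M) s)) := fun s hs =>
    IsLocalization.map_units (LocalizedAt N 𝔪)
      (⟨inclusion R N s, s, hs, rfl⟩ : 𝔪.primeCompl.map (inclusion R N))
  let a : Fin (2 * n) := ⟨0, by omega⟩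
  have hsa : sig a = ⟨1, by omega⟩ := rfl
  have haz : z ≠ a := fun h => by
    have := congrArg Fin.val h
    simp only [a] at this
    omega
  have hsaz : z ≠ sig a := fun h => by
    rw [hsa] at h
    have := congrArg Fin.val h
    simp only at this
    omega
  have he₁ : (e₁ : Fin (2 * n) → LocalizedAt N 𝔪) a = 1 := if_pos rfl
  have he₁' : ∀ i, i ≠ a → (e₁ : Fin (2 * n) → LocalizedAt N 𝔪) i = 0 :=
    fun i hi => if_neg fun h => hi (Fin.ext h)
  constructor
  · obtain ⟨v, huv, x, y, hxy⟩ := exists_rel_comaximal_localized hft h𝒢 𝔪 (LocalizedAt N 𝔪) hA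
      (isMoveRel_ESp n (AddMonoidAlgebra R M)) haz hsaz (Or.inl (hasDiagMoves_ESp n _)) u hu
      hlast
    exact (huv.map _ (ESp_le_comap _)).trans (rel_of_hasDiagMoves (isMoveRel_ESp n _)
      (hasDiagMoves_ESp n _) haz hsaz _ x y hxy _ he₁ he₁')
  · intro hn3 h2 hiso
    -- Index `2` starts the second pair, which differs from the last one because `n ≥ 3`.
    let b : Fin (2 * n) := ⟨2, by omega⟩
    have hsz : (sig z : ℕ) = 2 * n - 2 := by
      simp only [sig]
      split_ifs <;> omega
    have hba : b ≠ a := fun h => absurd (congrArg Fin.val h) (by simp [a, b])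
    have hbsa : b ≠ sig a := fun h => absurd (congrArg Fin.val h) (by simp [hsa, b])
    have hbz : b ≠ z := fun h => by
      have := congrArg Fin.val h
      simp only [b] at this
      omega
    have hbsz : b ≠ sig z := fun h => by
      have := congrArg Fin.val h
      rw [hsz] at this
      simp only [b] at this
      omega
    obtain ⟨v, huv, x, y, hxy⟩ := exists_rel_comaximal_localized hft h𝒢 𝔪 (LocalizedAt N 𝔪) hA
      (isMoveRel_EO n (AddMonoidAlgebra R M)) haz hsaz (Or.inr ⟨b, hba, hbsa, hbz, hbsz⟩) u hu
      hlast
    have huv' := huv.map (algebraMap (AddMonoidAlgebra R M) (LocalizedAt N 𝔪)) (EO_le_comap _)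
    have hiso' : IsIsotropic (localizeRow N 𝔪 u) := by
      rw [IsIsotropic, dotProduct_psi] at hiso ⊢
      have := congrArg (algebraMap (AddMonoidAlgebra R M) (LocalizedAt N 𝔪)) hiso
      simpa [localizeRow] using this
    have h2' : (2 : LocalizedAt N 𝔪) ∈ nonZeroDivisors (LocalizedAt N 𝔪) := by
      have := IsLocalization.map_nonZeroDivisors_le (𝔪.primeCompl.map (inclusion R N))
        (LocalizedAt N 𝔪) (Submonoid.mem_map_of_mem _ (two_mem_nonZeroDivisors (M := M) h2))
      change algebraMap (AddMonoidAlgebra R M) (LocalizedAt N 𝔪) 2 ∈ _ at this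
      rwa [map_ofNat] at this
    exact huv'.trans (rel_of_isIsotropic (isMoveRel_EO n _) hsaz hba hbsa hbz hbsz _ x y hxy
      (fun w hw => isIsotropic_of_orbitRel (huv'.trans hw) hiso') h2' _ he₁ he₁')

end Inclusion

end PyramidalMonoid

open PyramidalMonoid
theorem lemma5p4 {R : Type*} [CommRing R] [IsNoetherianRing R] {d : ℕ}
    (M : AddSubmonoid (Fin d → ℤ)) (hM : IsAffinePositiveNormal M) (H : CuttingHyperplane M)
    (m : M) (Δ Γ : Set (Fin d → ℝ)) (hdec : IsPyramidalDecomposition H m Δ Γ)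
    (δ : (Fin d → ℝ) →ₗ[ℝ] ℝ) (hδ : IsPyramidalFunctional M Δ Γ δ)
    (n : ℕ) (hn : 2 ≤ n) (u : Fin (2 * n) → AddMonoidAlgebra R M) (hu : IsUnimodular u)
    (hlast : IsMonicIn δ m (u ⟨2 * n - 1, by omega⟩))
    (𝔪 : Ideal (AddMonoidAlgebra R (H.submonoid Γ hdec.polytope_Γ.convex))) [𝔪.IsMaximal] :
    OrbitRel (ESp (LocalizedAt (H.submonoid Γ hdec.polytope_Γ.convex) 𝔪) n)
        (localizeRow (H.submonoid Γ hdec.polytope_Γ.convex) 𝔪 u) e₁ ∧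
      (3 ≤ n → (2 : R) ∈ nonZeroDivisors R → IsIsotropic u →
        OrbitRel (EO (LocalizedAt (H.submonoid Γ hdec.polytope_Γ.convex) 𝔪) n)
          (localizeRow (H.submonoid Γ hdec.polytope_Γ.convex) 𝔪 u) e₁) := by
  -- Over the zero ring there would be no maximal ideal `𝔪`.
  have hR : Nontrivial R := by
    by_contra hR
    rw [not_nontrivial_iff_subsingleton] at hR
    exact ‹𝔪.IsMaximal›.ne_top (Subsingleton.elim _ _)
  obtain ⟨𝒢, h𝒢, hmonic⟩ := exists_isMonicSet (R := R) hM hdec hδ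
  exact orbitRel_e₁_localizeRow hM.fg h𝒢 hn u hu _ rfl (hmonic _ hlast) 𝔪
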